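/- Let $\theta>-1$, $\beta>0$ and $\varepsilon>0$. There exist a constant $C>0$ and a function $\delta:\mathbb R\to\mathbb R$ with $\delta(T)\to0$ as $T\to\infty$, both depending only on $\theta,\beta,\varepsilon$, such that the following holds for every $T\ge 10^9$ and every real $\sigma$ with $$\tfrac12\le\sigma\le\tfrac12+(\log T)^{\theta-3\varepsilon}.$$ If $\tau$ is a random variable uniformly distributed on $[T,2T]$ and $\zeta$ denotes the Riemann zeta function, then with probability at least $1-\delta(T)$, $$\int_{-(\log T)^{\theta}}^{(\log T)^{\theta}}|\zeta(\sigma+\mathrm i\tau+\mathrm i u)|^{\beta}\,\mathrm du\;\le\; C\left(\int_{-2(\log T)^{\theta}}^{2(\log T)^{\theta}}|\zeta(\tfrac12+\mathrm i\tau+\mathrm i u)|^{\beta}\,\mathrm du+\frac1{(\log T)^{7}}\right).$$ -/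

import Mathlib

open MeasureTheory

/-- The law of `τ`: the uniform probability distribution on `[T, 2T]` (Lebesgue measure
conditioned to this interval), for `T > 0`. -/
noncomputable def uniformLaw (T : ℝ) : Measure ℝ :=
  ProbabilityTheory.cond volume (Set.Icc T (2 * T))

/-- The moment `∫_{-H}^{H} |ζ(σ + i t + i u)|^β du`. -/
noncomputable def zetaMoment (β σ t H : ℝ) : ℝ :=
  ∫ u in (-H)..H,
    ‖riemannZeta ((σ : ℂ) + Complex.I * (t : ℂ) + Complex.I * (u : ℂ))‖ ^ β

/-!
The function `|ζ|^β` is subharmonic for every `β > 0`, and so are its localized versions. The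
integral of a rapidly decaying subharmonic function over the vertical line `Re z = x` is therefore
a convex function of `x`, and in a strip it is bounded by its values on the two edges
(`integral_vertical_le_add`; the mean value inequality `norm_rpow_le_circleAverage` is Jensen's
formula combined with the convexity of `exp`).

Write `L = log T`, `H = L ^ θ`, `Δ = L ^ (θ - 2ε)`, `κ = L ^ (ε - θ)`. To have an entire function
to work with, `ζ` is replaced by `ζ₁(s) = (s - 1) ζ(s)`, where the additional factor has size about
`T` in the relevant range. The convexity principle is applied on the strip `0 ≤ Re z ≤ Δ` to
`localizedZeta`, that is, to
`ζ₁(1/2 + iτ + z) * exp (-cos (κ z) / cosh (κ H)) * exp (-μ z / β)`.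

* The second factor is at least `1/e` in modulus for `|Im z| ≤ H`. For `|Im z| ≥ 2H` it is at most
  `exp (-cosh (L ^ ε) / 2)` and decays doubly exponentially in `κ |Im z|`. This is smaller than any
  negative power of `T`, so a polynomial bound for `ζ₁` is enough there
  (`eventually_norm_riemannZeta₁_rpow_mul_exp_le`).
* The third factor is chosen so that `exp (-μ Δ) = L ^ (-B)`. The contribution of the right edge is
  thus reduced by an arbitrary fixed power of `L`. On the other hand `σ - 1/2` is at most
  `Δ * L ^ (-ε)`, so at `Re z = σ - 1/2` only the bounded factor `exp (B * log L / L ^ ε)` is lost.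

It remains to bound `ζ` by some fixed power of `L` on the segment
`Re s = 1/2 + Δ`, `|Im s - τ| ≤ 2H`, for all `τ` outside a set of probability `O(1 / L)`
(`exists_uniformLaw_norm_riemannZeta₁_le`). By subharmonicity in discs and Markov's inequality this
follows from the mean square bound `∫ |ζ(σ + it)|² dt ≪ T log T` over `T / 2 ≤ t ≤ 3 T`, uniformly
in `1/2 ≤ σ ≤ T` (`exists_lintegral_normSq_riemannZeta₁_le`). For the mean square one writes
`ζ(s) = ∑_{n ≤ N} n^(-s) + N^(1-s) / (s-1) - s ∫_N^∞ {v} v^(-s-1) dv` with `N = ⌊T⌋`. Both the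
Dirichlet polynomial and the remainder integral are Fourier transforms of measures on the
logarithmic scale, and both mean squares come out of one Schur test with a Gaussian weight in `t`
(`lintegral_normSq_integral_cexp_mul_gaussian_le`). This saves a factor
`T` over the trivial mean square of the remainder integral, enough to offset the factor `|s|² ≈ T²`
in front of it, so no estimate for exponential sums is needed.
-/

open MeasureTheory

/-! ### Subharmonicity of `‖f‖ ^ β` and convexity of its vertical integrals -/

open Real Metric Set in
/-- The submean value property of `‖f‖ ^ β`. Jensen's formula gives it for `log ‖f‖`, and it is
transferred by the convexity of `exp`; this covers exponents `β < 1`, where `‖·‖ ^ β` is not convex. -/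
theorem norm_rpow_le_circleAverage {f : ℂ → ℂ} (hf : Differentiable ℂ f) {β : ℝ} (hβ : 0 < β)
    (c : ℂ) {r : ℝ} (hr : 0 < r) :
    ‖f c‖ ^ β ≤ circleAverage (fun z ↦ ‖f z‖ ^ β) c r := by
  have hpow : Continuous fun z ↦ ‖f z‖ ^ β :=
    hf.continuous.norm.rpow_const fun _ ↦ Or.inr hβ.le
  have hint : CircleIntegrable (fun z ↦ ‖f z‖ ^ β) c r := hpow.continuousOn.circleIntegrable hr.le
  by_cases hc : f c = 0
  · rw [hc, norm_zero, zero_rpow hβ.ne']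
    exact circleAverage_nonneg_of_nonneg fun z _ ↦ by positivity
  have hana : AnalyticOnNhd ℂ f univ := fun z _ ↦ hf.analyticAt z
  have hball := hana.mono (subset_univ (closedBall c |r|))
  have hlog : CircleIntegrable (fun z ↦ log ‖f z‖) c r :=
    MeromorphicOn.circleIntegrable_log_norm fun z _ ↦ (hf.analyticAt z).meromorphicAt
  set m : ℝ := β * log ‖f c‖ with hm
  have hexp : rexp m = ‖f c‖ ^ β := by
    rw [rpow_def_of_pos (norm_pos_iff.mpr hc), hm, mul_comm]
  have hjensen : log ‖f c‖ ≤ circleAverage (fun z ↦ log ‖f z‖) c r := by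
    rw [hball.circleAverage_log_norm hr.ne' hc]
    refine le_add_of_nonneg_left (finsum_nonneg fun u ↦ ?_)
    by_cases hu : u ∈ closedBall c |r|
    · refine mul_nonneg (mod_cast MeromorphicOn.AnalyticOnNhd.divisor_nonneg hball u) ?_
      by_cases huc : u = c
      · simp [huc]
      · have h0 : 0 < ‖c - u‖ := norm_pos_iff.mpr (sub_ne_zero.mpr (Ne.symm huc))
        refine log_nonneg ?_
        rw [← div_eq_mul_inv, one_le_div h0]
        simpa [dist_eq_norm, norm_sub_rev, abs_of_pos hr] using hu
    · rw [Function.locallyFinsuppWithin.apply_eq_zero_of_notMem _ hu]; simp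
  -- The tangent line of `exp` at `m`; at the zeros of `f` the convention `log 0 = 0` spoils the
  -- inequality, so the value there is replaced by `0`.
  set g : ℂ → ℝ := fun z ↦ rexp m * (1 - m) + (rexp m * β) * log ‖f z‖ with hg
  classical
  have hgint : CircleIntegrable g c r :=
    (circleIntegrable_const _ c r).add (hlog.const_fun_smul (a := rexp m * β))
  have hne : ∀ᶠ z in Filter.codiscreteWithin (sphere c |r|), f z ≠ 0 := by
    have := hana.preimage_zero_mem_codiscreteWithin (x := c) hc (mem_univ _) (by exact isConnected_univ)
    filter_upwards [Filter.codiscreteWithin_mono (subset_univ _) this] with z hz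
    simpa using hz
  set h : ℂ → ℝ := fun z ↦ if f z = 0 then 0 else g z with hh
  have hgh : g =ᶠ[Filter.codiscreteWithin (sphere c |r|)] h := by
    filter_upwards [hne] with z hz
    simp [hh, hz]
  have hhint : CircleIntegrable h c r := hgint.congr_codiscreteWithin hgh 
  calc ‖f c‖ ^ β = rexp m * (1 - m) + (rexp m * β) * log ‖f c‖ := by rw [← hexp, hm]; ring
    _ ≤ rexp m * (1 - m) + (rexp m * β) * circleAverage (fun z ↦ log ‖f z‖) c r := by gcongr
    _ = circleAverage g c r := by
      have := circleAverage_fun_add (circleIntegrable_const (rexp m * (1 - m)) c r)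
        (hlog.const_fun_smul (a := rexp m * β))
      rw [circleAverage_const, circleAverage_fun_smul] at this
      exact this.symm
    _ = circleAverage h c r := circleAverage_congr_codiscreteWithin hgh hr.ne'
    _ ≤ _ := by
      refine circleAverage_mono hhint hint fun z _ ↦ ?_
      by_cases hz : f z = 0
      · simp [hh, hz]; positivity
      · simp only [hh, hz, if_false, hg]
        rw [rpow_def_of_pos (norm_pos_iff.mpr hz)]
        have := add_one_le_exp (log ‖f z‖ * β - m)
        rw [exp_sub, le_div_iff₀ (exp_pos m)] at this
        linarith

open Real Set in
/-- A three lines principle in the mean. The vertical integral of `‖f‖ ^ β` satisfies a mean value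
inequality in `x`, inherited from `‖f‖ ^ β` by integrating over vertical translates of a circle, so
it has no interior maximum. -/
theorem integral_vertical_le_add {f : ℂ → ℂ} (hf : Differentiable ℂ f) {β : ℝ} (hβ : 0 < β)
    {Δ C : ℝ} (hΔ : 0 < Δ)
    (hC : ∀ x ∈ Icc 0 Δ, ∀ y : ℝ, ‖f (x + y * Complex.I)‖ ^ β ≤ C / (1 + y ^ 2))
    {x : ℝ} (hx : x ∈ Icc 0 Δ) :
    ∫ y : ℝ, ‖f (x + y * Complex.I)‖ ^ β ≤
      (∫ y : ℝ, ‖f ((0 : ℝ) + y * Complex.I)‖ ^ β) + ∫ y : ℝ, ‖f (Δ + y * Complex.I)‖ ^ β := by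
  set φ : ℝ → ℝ → ℝ := fun x y ↦ ‖f (x + y * Complex.I)‖ ^ β with hφ
  have hcont : Continuous (Function.uncurry φ) := by
    refine (hf.continuous.comp ?_).norm.rpow_const fun _ ↦ Or.inr hβ.le
    fun_prop
  have hφ0 : ∀ x y, 0 ≤ φ x y := fun x y ↦ by positivity
  have hC0 : 0 ≤ C := by
    have := (hφ0 0 0).trans (hC 0 ⟨le_rfl, hΔ.le⟩ 0)
    simpa using this
  have hdom : Integrable fun y : ℝ ↦ C / (1 + y ^ 2) := by
    simpa [div_eq_mul_inv] using integrable_inv_one_add_sq.const_mul C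
  set J : ℝ → ℝ := fun x ↦ ∫ y, φ x y with hJ
  have hJcont : ContinuousOn J (Icc 0 Δ) := by
    refine continuousOn_of_dominated (bound := fun y ↦ C / (1 + y ^ 2)) ?_ ?_ hdom ?_
    · intro x _
      exact (hcont.comp (Continuous.prodMk_right x)).aestronglyMeasurable
    · intro x hx
      exact .of_forall fun y ↦ by rw [norm_of_nonneg (hφ0 x y)]; exact hC x hx y
    · exact .of_forall fun y ↦ (hcont.comp (Continuous.prodMk_left y)).continuousOn
  have hsub : ∀ x r : ℝ, 0 < r → 0 ≤ x - r → x + r ≤ Δ →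
      J x ≤ (2 * π)⁻¹ * ∫ t in (0)..(2 * π), J (x + r * cos t) := by
    intro x r hr h0 h1
    have hmem : ∀ t, x + r * cos t ∈ Icc 0 Δ := fun t ↦
      ⟨by nlinarith [neg_one_le_cos t], by nlinarith [cos_le_one t]⟩
    have hint : Integrable (Function.uncurry fun y t ↦ φ (x + r * cos t) (y + r * sin t))
        (volume.prod (volume.restrict (Ioc 0 (2 * π)))) := by
      have hg : Integrable (fun p : ℝ × ℝ ↦ (C * (2 * (1 + r ^ 2)) / (1 + p.1 ^ 2)) * (1 : ℝ))
          (volume.prod (volume.restrict (Ioc 0 (2 * π)))) := by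
        refine Integrable.mul_prod (f := fun y : ℝ ↦ C * (2 * (1 + r ^ 2)) / (1 + y ^ 2))
          (g := fun _ : ℝ ↦ (1 : ℝ)) ?_ (integrable_const _)
        simpa [div_eq_mul_inv] using integrable_inv_one_add_sq.const_mul (C * (2 * (1 + r ^ 2)))
      refine hg.mono' ?_ (.of_forall ?_)
      · refine Continuous.aestronglyMeasurable ?_
        exact hcont.comp (f := fun p : ℝ × ℝ ↦ (x + r * cos p.2, p.1 + r * sin p.2)) (by fun_prop)
      · rintro ⟨y, t⟩
        simp only [Function.uncurry, mul_one]
        rw [norm_of_nonneg (hφ0 _ _)]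
        refine (hC _ (hmem t) _).trans ?_
        rw [div_le_div_iff₀ (by positivity) (by positivity), mul_assoc]
        refine mul_le_mul_of_nonneg_left ?_ hC0
        have hs : (r * sin t) ^ 2 ≤ r ^ 2 := by
          nlinarith [sin_sq_le_one t, sq_nonneg r]
        nlinarith [sq_nonneg (y + 2 * (r * sin t)), sq_nonneg (y + r * sin t), sq_nonneg r,
          mul_nonneg (sq_nonneg r) (sq_nonneg (y + r * sin t))]
    have hpt : ∀ y, φ x y ≤
        (2 * π)⁻¹ * ∫ t in Ioc 0 (2 * π), φ (x + r * cos t) (y + r * sin t) := by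
      intro y
      have := norm_rpow_le_circleAverage hf hβ (x + y * Complex.I) hr
      rw [circleAverage_def, smul_eq_mul, intervalIntegral.integral_of_le (by positivity)] at this
      refine this.trans_eq ?_
      congr 1
      refine integral_congr_ae (.of_forall fun t ↦ ?_)
      simp only [hφ, circleMap]
      congr 3
      rw [Complex.exp_mul_I]
      push_cast
      ring
    calc J x ≤ ∫ y, (2 * π)⁻¹ * ∫ t in Ioc 0 (2 * π), φ (x + r * cos t) (y + r * sin t) := by
          refine integral_mono_of_nonneg (.of_forall fun y ↦ hφ0 x y) ?_ (.of_forall hpt)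
          exact hint.integral_prod_left.const_mul _
      _ = (2 * π)⁻¹ * ∫ t in Ioc 0 (2 * π), ∫ y, φ (x + r * cos t) (y + r * sin t) := by
          rw [integral_const_mul, integral_integral_swap hint]
      _ = _ := by
          rw [intervalIntegral.integral_of_le (by positivity)]
          congr 1
          refine integral_congr_ae (.of_forall fun t ↦ ?_)
          exact integral_add_right_eq_self (φ (x + r * cos t)) (r * sin t)
  have hJ0 : ∀ x, 0 ≤ J x := fun x ↦ integral_nonneg (hφ0 x)
  -- The perturbation `η * x ^ 2` makes the mean value inequality strict.
  have key : ∀ η > 0, J x ≤ J 0 + J Δ + η * Δ ^ 2 := by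
    intro η hη
    have hhc : ContinuousOn (fun x ↦ J x + η * x ^ 2) (Icc 0 Δ) := by fun_prop
    obtain ⟨m, hm, hmax⟩ := isCompact_Icc.exists_isMaxOn ⟨x, hx⟩ hhc
    have hxm : J x + η * x ^ 2 ≤ J m + η * m ^ 2 := hmax hx
    have hxx : 0 ≤ η * x ^ 2 := by positivity
    rcases hm.1.eq_or_lt with h0 | h0
    · rw [← h0] at hxm
      nlinarith [hJ0 Δ, sq_nonneg Δ, mul_nonneg hη.le (sq_nonneg Δ)]
    rcases hm.2.eq_or_lt with h1 | h1
    · rw [h1] at hxm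
      linarith [hJ0 0]
    exfalso
    -- An interior maximum at `m` contradicts the mean value inequality on any circle in the strip.
    set r := min m (Δ - m) with hrdef
    have hr : 0 < r := lt_min h0 (by linarith)
    have hr1 : r ≤ m := min_le_left _ _
    have hr2 : r ≤ Δ - m := min_le_right _ _
    have hmem : ∀ t, m + r * cos t ∈ Icc 0 Δ := fun t ↦
      ⟨by nlinarith [neg_one_le_cos t], by nlinarith [cos_le_one t]⟩
    have h2 := hsub m r hr (by linarith) (by linarith)
    have hJc : Continuous fun t ↦ J (m + r * cos t) :=
      hJcont.comp_continuous (by fun_prop) hmem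
    have h3 : ∫ t in (0)..(2 * π), J (m + r * cos t) ≤
        ∫ t in (0)..(2 * π), (J m - 2 * η * m * r * cos t - η * r ^ 2 * cos t ^ 2) := by
      refine intervalIntegral.integral_mono_on (by positivity) (hJc.intervalIntegrable _ _)
        (Continuous.intervalIntegrable (by fun_prop) _ _) fun t _ ↦ ?_
      have : J (m + r * cos t) + η * (m + r * cos t) ^ 2 ≤ J m + η * m ^ 2 := hmax (hmem t)
      nlinarith
    have h4 : ∫ t in (0)..(2 * π), (J m - 2 * η * m * r * cos t - η * r ^ 2 * cos t ^ 2) =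
        2 * π * (J m - η * r ^ 2 / 2) := by
      rw [intervalIntegral.integral_sub, intervalIntegral.integral_sub,
        intervalIntegral.integral_const_mul, intervalIntegral.integral_const_mul,
        integral_cos_sq, integral_cos]
      · simp; ring
      all_goals exact Continuous.intervalIntegrable (by fun_prop) _ _
    rw [h4] at h3
    have h5 : J m ≤ J m - η * r ^ 2 / 2 := by
      refine h2.trans ?_
      rw [inv_mul_le_iff₀ (by positivity)]
      exact h3
    nlinarith [mul_pos hη (pow_pos hr 2)]
  refine le_of_forall_pos_le_add fun η hη ↦ ?_
  have := key (η / Δ ^ 2) (by positivity)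
  rwa [div_mul_cancel₀ _ (by positivity)] at this

open Real Set Metric in
theorem ofReal_mul_norm_rpow_le_lintegral_ball {f : ℂ → ℂ} (hf : Differentiable ℂ f) {β : ℝ}
    (hβ : 0 < β) (c : ℂ) {r : ℝ} (hr : 0 < r) :
    ENNReal.ofReal (π * r ^ 2) * ENNReal.ofReal (‖f c‖ ^ β) ≤
      ∫⁻ z in ball c r, ENNReal.ofReal (‖f z‖ ^ β) := by
  have hpow : Continuous fun z ↦ ‖f z‖ ^ β :=
    hf.continuous.norm.rpow_const fun _ ↦ Or.inr hβ.le
  set g : ℂ → ENNReal := fun z ↦ ENNReal.ofReal (‖f (c + z)‖ ^ β) with hg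
  have hgm : Measurable g := by
    refine ENNReal.measurable_ofReal.comp (hpow.measurable.comp (by fun_prop))
  have h1 : ∫⁻ z in ball c r, ENNReal.ofReal (‖f z‖ ^ β) = ∫⁻ z in ball 0 r, g z := by
    rw [← lintegral_indicator measurableSet_ball, ← lintegral_indicator measurableSet_ball,
      ← lintegral_add_left_eq_self _ c]
    congr 1 with z
    simp [indicator, hg]
  have hcont : Continuous fun p : ℝ × ℝ ↦ Complex.polarCoord.symm p := by
    simp only [Complex.polarCoord_symm_apply]; fun_prop
  have h2 : ∫⁻ p in Ioo 0 r ×ˢ Ioo (-π) π, ENNReal.ofReal p.1 * g (Complex.polarCoord.symm p)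
      ≤ ∫⁻ z in ball 0 r, g z := by
    rw [← lintegral_indicator measurableSet_ball, ← Complex.lintegral_comp_polarCoord_symm]
    refine (setLIntegral_mono' (measurableSet_Ioo.prod measurableSet_Ioo) ?_).trans
      (lintegral_mono_set ?_)
    · rintro ⟨ρ, t⟩ ⟨hρ, ht⟩
      rw [smul_eq_mul, indicator_of_mem]
      rw [mem_ball_zero_iff, Complex.norm_polarCoord_symm, abs_of_pos hρ.1]
      exact hρ.2
    · rintro ⟨ρ, t⟩ ⟨hρ, ht⟩
      exact ⟨hρ.1, ht⟩
  rw [h1]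
  refine le_trans ?_ h2
  have hm : Measurable fun p : ℝ × ℝ ↦
      ENNReal.ofReal p.1 * g (Complex.polarCoord.symm p) :=
    (ENNReal.measurable_ofReal.comp measurable_fst).mul (hgm.comp hcont.measurable)
  rw [Measure.volume_eq_prod, ← Measure.prod_restrict, lintegral_prod _ hm.aemeasurable]
  have h3 : ∀ ρ ∈ Ioo 0 r, ENNReal.ofReal (ρ * (2 * π * ‖f c‖ ^ β)) ≤
      ∫⁻ t in Ioo (-π) π, ENNReal.ofReal ρ * g (Complex.polarCoord.symm (ρ, t)) := by
    intro ρ hρ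
    have hmean := norm_rpow_le_circleAverage hf hβ c hρ.1
    rw [circleAverage_eq_integral_add (-π), smul_eq_mul] at hmean
    have hc : Continuous fun t : ℝ ↦ ‖f (circleMap c ρ t)‖ ^ β := hpow.comp (by fun_prop)
    rw [intervalIntegral.integral_comp_add_right (fun t ↦ ‖f (circleMap c ρ t)‖ ^ β),
      intervalIntegral.integral_of_le (by linarith [pi_pos]), integral_Ioc_eq_integral_Ioo,
      le_inv_mul_iff₀ (by positivity), zero_add, show 2 * π + -π = π by ring] at hmean
    rw [lintegral_const_mul' _ _ ENNReal.ofReal_ne_top,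
      ENNReal.ofReal_mul hρ.1.le]
    gcongr
    refine (ENNReal.ofReal_le_ofReal hmean).trans_eq ?_
    rw [ofReal_integral_eq_lintegral_ofReal]
    · refine lintegral_congr fun t ↦ ?_
      simp only [hg, circleMap]
      congr 4
      rw [Complex.polarCoord_symm_apply, Complex.exp_mul_I]
      simp
    · exact (hc.integrableOn_Icc (a := -π) (b := π)).mono_set Ioo_subset_Icc_self
    · exact .of_forall fun t ↦ by positivity
  refine le_trans (le_of_eq ?_) (setLIntegral_mono' measurableSet_Ioo h3)
  rw [← ofReal_integral_eq_lintegral_ofReal, integral_mul_const, ← integral_Ioc_eq_integral_Ioo,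
    ← intervalIntegral.integral_of_le hr.le, integral_id, ← ENNReal.ofReal_mul (by positivity)]
  · congr 1; ring
  · exact (Continuous.integrableOn_Icc (by fun_prop) (a := 0) (b := r)).mono_set Ioo_subset_Icc_self
  · filter_upwards [ae_restrict_mem measurableSet_Ioo] with ρ hρ
    have := hρ.1.le
    simp only [Pi.zero_apply]
    positivity

open Real Set Metric in
theorem ofReal_mul_norm_rpow_le_lintegral_square {f : ℂ → ℂ} (hf : Differentiable ℂ f) {β : ℝ}
    (hβ : 0 < β) (x y : ℝ) {r : ℝ} (hr : 0 < r) :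
    ENNReal.ofReal (π * r ^ 2) * ENNReal.ofReal (‖f (x + y * Complex.I)‖ ^ β) ≤
      ∫⁻ u in Icc (x - r) (x + r), ∫⁻ v in Icc (y - r) (y + r),
        ENNReal.ofReal (‖f (u + v * Complex.I)‖ ^ β) := by
  refine (ofReal_mul_norm_rpow_le_lintegral_ball hf hβ (x + y * Complex.I) hr).trans ?_
  have hpow : Continuous fun z ↦ ‖f z‖ ^ β :=
    hf.continuous.norm.rpow_const fun _ ↦ Or.inr hβ.le
  have hm : Measurable fun p : ℝ × ℝ ↦ ENNReal.ofReal (‖f (p.1 + p.2 * Complex.I)‖ ^ β) :=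
    ENNReal.measurable_ofReal.comp (hpow.comp (by fun_prop)).measurable
  rw [← lintegral_prod _ hm.aemeasurable, Measure.prod_restrict, ← Measure.volume_eq_prod,
    ← Complex.volume_preserving_equiv_real_prod.setLIntegral_comp_preimage_emb
      Complex.measurableEquivRealProd.measurableEmbedding]
  simp only [Complex.measurableEquivRealProd_apply, Complex.re_add_im]
  refine lintegral_mono_set fun z hz ↦ ?_
  rw [mem_ball_iff_norm] at hz
  have h1 := (Complex.abs_re_le_norm _).trans hz.le
  have h2 := (Complex.abs_im_le_norm _).trans hz.le
  simp [abs_le] at h1 h2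
  simp
  refine ⟨⟨?_, ?_⟩, ?_, ?_⟩ <;> linarith

/-! ### Mean squares of Fourier transforms with a Gaussian weight -/

open Real in
theorem integral_cexp_mul_gaussian {A : ℝ} (hA : 0 < A) (a : ℝ) :
    ∫ t : ℝ, Complex.exp (-(Complex.I * t * a)) * Complex.exp (-(t / A : ℝ) ^ 2) =
      ((√π * A * rexp (-(A * a) ^ 2 / 4) : ℝ) : ℂ) := by
  have h := fourierIntegral_gaussian (b := ((1 / A ^ 2 : ℝ) : ℂ))
    (by rw [Complex.ofReal_re]; positivity) (-a)
  have h2 : ((π : ℂ) / ((1 / A ^ 2 : ℝ) : ℂ)) ^ (1 / 2 : ℂ) = ((√π * A : ℝ) : ℂ) := by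
    rw [← Complex.ofReal_div, show (1 / 2 : ℂ) = ((1 / 2 : ℝ) : ℂ) by norm_num,
      ← Complex.ofReal_cpow (by positivity), ← sqrt_eq_rpow, div_div_eq_mul_div, div_one, sqrt_mul (by positivity),
      sqrt_sq hA.le]
  rw [h2] at h
  rw [Complex.ofReal_mul, Complex.ofReal_exp]
  convert h using 1
  · refine integral_congr_ae (.of_forall fun t ↦ ?_)
    simp only
    congr 2
    · ring
    · push_cast; field_simp
  · congr 2
    have : (A : ℂ) ≠ 0 := by exact_mod_cast hA.ne'
    push_cast
    field_simp

open Real in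
/-- A weighted `L²` bound for the exponential transform `t ↦ ∫ f(x) e^{-itφ(x)} dμ(x)`. Opening the
square and integrating over `t` leaves the positive kernel `e^{-A²(φ(x) - φ(y))²/4}`, to which
Schur's test applies. For counting measure and `φ = log` this is a mean value theorem for Dirichlet
polynomials; for Lebesgue measure it replaces Plancherel's theorem. -/
theorem lintegral_normSq_integral_cexp_mul_gaussian_le {X : Type*} [MeasurableSpace X]
    {μ : Measure X} [SFinite μ] {f : X → ℂ} (hf : Integrable f μ) {φ : X → ℝ} (hφ : Measurable φ)
    {A : ℝ} (hA : 0 < A) {K : ENNReal}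
    (hK : ∀ y, ∫⁻ x, ENNReal.ofReal (rexp (-(A * (φ x - φ y)) ^ 2 / 4)) ∂μ ≤ K) :
    ∫⁻ t : ℝ, ENNReal.ofReal
        (‖∫ x, f x * Complex.exp (-(Complex.I * t * φ x)) ∂μ‖ ^ 2 * rexp (-(t / A) ^ 2)) ≤
      ENNReal.ofReal (√π * A) * K * ∫⁻ x, ENNReal.ofReal (‖f x‖ ^ 2) ∂μ := by
  set G : ℝ → ℂ := fun t ↦ ∫ x, f x * Complex.exp (-(Complex.I * t * φ x)) ∂μ with hG
  set h : ℝ → X × X → ℂ := fun t p ↦ f p.1 * (starRingEnd ℂ) (f p.2) *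
    (Complex.exp (-(Complex.I * t * (φ p.1 - φ p.2 : ℝ))) * Complex.exp (-(t / A : ℝ) ^ 2)) with hh
  have hgauss : Integrable fun t : ℝ ↦ rexp (-(t / A) ^ 2) := by
    have := integrable_exp_neg_mul_sq (b := 1 / A ^ 2) (by positivity)
    refine this.congr (.of_forall fun t ↦ ?_)
    simp only
    congr 1
    field_simp
  have hconj : Integrable (fun x ↦ (starRingEnd ℂ) (f x)) μ :=
    (Complex.conjLIE.integrable_comp_iff).mpr hf
  have hff := hf.mul_prod hconj
  have hexpn : ∀ (t a : ℝ), ‖Complex.exp (-(Complex.I * t * a))‖ = 1 := by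
    intro t a
    rw [Complex.norm_exp]; simp
  have hint : Integrable (Function.uncurry h) (volume.prod (μ.prod μ)) := by
    refine (hgauss.norm.mul_prod hff.norm).mono' ?_ (.of_forall ?_)
    · have h1 : AEStronglyMeasurable (fun p : ℝ × X × X ↦ f p.2.1 * (starRingEnd ℂ) (f p.2.2))
          (volume.prod (μ.prod μ)) := hff.aestronglyMeasurable.comp_snd
      refine h1.mul (Measurable.aestronglyMeasurable ?_)
      fun_prop
    · rintro ⟨t, x, y⟩
      simp only [Function.uncurry, hh, norm_mul]
      rw [hexpn, one_mul, mul_comm]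
      refine le_of_eq ?_
      congr 1
      rw [← Complex.ofReal_pow, ← Complex.ofReal_neg, ← Complex.ofReal_exp, Complex.norm_real]
  -- Opening the square.
  have hsq : ∀ t : ℝ, ((‖G t‖ ^ 2 * rexp (-(t / A) ^ 2) : ℝ) : ℂ) = ∫ p, h t p ∂μ.prod μ := by
    intro t
    have h1 : (‖G t‖ ^ 2 : ℂ) = G t * ∫ y, (starRingEnd ℂ) (f y) *
        Complex.exp (Complex.I * t * φ y) ∂μ := by
      rw [← Complex.mul_conj', hG]
      simp only
      rw [← integral_conj]
      congr 2 with y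
      rw [map_mul, ← Complex.exp_conj]
      simp
    rw [Complex.ofReal_mul, Complex.ofReal_pow, h1, hG]
    simp only
    rw [← integral_prod_mul, ← integral_mul_const]
    congr 1 with p
    simp only [hh]
    rw [show (-(Complex.I * t * ((φ p.1 - φ p.2 : ℝ) : ℂ))) =
      -(Complex.I * t * φ p.1) + Complex.I * t * φ p.2 by push_cast; ring, Complex.exp_add]
    push_cast
    ring
  have hGint : Integrable fun t ↦ ‖G t‖ ^ 2 * rexp (-(t / A) ^ 2) := by
    have := hint.integral_prod_left
    simp only [Function.uncurry] at this
    simp_rw [← hsq] at this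
    exact this.re
  have hswap : ((∫ t, ‖G t‖ ^ 2 * rexp (-(t / A) ^ 2) : ℝ) : ℂ) =
      ∫ p, f p.1 * (starRingEnd ℂ) (f p.2) *
        ((√π * A * rexp (-(A * (φ p.1 - φ p.2)) ^ 2 / 4) : ℝ) : ℂ) ∂μ.prod μ := by
    rw [← integral_complex_ofReal]
    simp_rw [hsq]
    rw [integral_integral_swap hint]
    congr 1 with p
    simp only [hh]
    rw [integral_const_mul, integral_cexp_mul_gaussian hA]
  set k : X → X → ENNReal := fun x y ↦
    ENNReal.ofReal (rexp (-(A * (φ x - φ y)) ^ 2 / 4)) with hk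
  have hksymm : ∀ x y, k x y = k y x := by
    intro x y
    simp only [hk]
    congr 3
    ring
  have hkm : Measurable (Function.uncurry k) := by
    simp only [hk, Function.uncurry_def]
    fun_prop
  have hfm : AEMeasurable (fun x ↦ ENNReal.ofReal (‖f x‖ ^ 2)) μ :=
    (hf.aestronglyMeasurable.norm.aemeasurable.pow_const 2).ennreal_ofReal
  have hhalf : ∫⁻ p, ENNReal.ofReal (‖f p.2‖ ^ 2) * k p.1 p.2 ∂μ.prod μ ≤
      K * ∫⁻ x, ENNReal.ofReal (‖f x‖ ^ 2) ∂μ := by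
    have hm : AEMeasurable (fun p : X × X ↦ ENNReal.ofReal (‖f p.2‖ ^ 2) * k p.1 p.2)
        (μ.prod μ) := hfm.comp_snd.mul hkm.aemeasurable
    rw [lintegral_prod_symm _ hm, ← lintegral_const_mul'' _ hfm]
    refine lintegral_mono fun y ↦ ?_
    simp only
    rw [lintegral_const_mul' _ _ ENNReal.ofReal_ne_top, mul_comm]
    gcongr
    exact hK y
  have hhalf' : ∫⁻ p, ENNReal.ofReal (‖f p.1‖ ^ 2) * k p.1 p.2 ∂μ.prod μ ≤
      K * ∫⁻ x, ENNReal.ofReal (‖f x‖ ^ 2) ∂μ := by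
    rw [← lintegral_prod_swap]
    refine le_trans (le_of_eq (lintegral_congr fun p ↦ ?_)) hhalf
    simp [hksymm p.2 p.1]
  rw [← ofReal_integral_eq_lintegral_ofReal hGint (.of_forall fun t ↦ by positivity)]
  have h0 : 0 ≤ ∫ t, ‖G t‖ ^ 2 * rexp (-(t / A) ^ 2) := integral_nonneg fun t ↦ by positivity
  calc ENNReal.ofReal (∫ t, ‖G t‖ ^ 2 * rexp (-(t / A) ^ 2))
      = ‖((∫ t, ‖G t‖ ^ 2 * rexp (-(t / A) ^ 2) : ℝ) : ℂ)‖ₑ := by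
        rw [← ofReal_norm, Complex.norm_real, norm_of_nonneg h0]
    _ ≤ ∫⁻ p, ‖f p.1 * (starRingEnd ℂ) (f p.2) *
        ((√π * A * rexp (-(A * (φ p.1 - φ p.2)) ^ 2 / 4) : ℝ) : ℂ)‖ₑ ∂μ.prod μ := by
        rw [hswap]; exact enorm_integral_le_lintegral_enorm _
    _ ≤ ∫⁻ p, ENNReal.ofReal (√π * A) * (2⁻¹ * (ENNReal.ofReal (‖f p.1‖ ^ 2) * k p.1 p.2 +
          ENNReal.ofReal (‖f p.2‖ ^ 2) * k p.1 p.2)) ∂μ.prod μ := by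
        refine lintegral_mono fun p ↦ ?_
        simp only [hk]
        rw [← ofReal_norm, ← add_mul, ← ENNReal.ofReal_add (by positivity) (by positivity),
          ← ENNReal.ofReal_mul (by positivity),
          show (2⁻¹ : ENNReal) = ENNReal.ofReal 2⁻¹ by
            rw [ENNReal.ofReal_inv_of_pos two_pos, ENNReal.ofReal_ofNat],
          ← ENNReal.ofReal_mul (by positivity), ← ENNReal.ofReal_mul (by positivity)]
        refine ENNReal.ofReal_le_ofReal ?_
        rw [norm_mul, norm_mul, Complex.norm_real, norm_of_nonneg (by positivity), RCLike.norm_conj]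
        have := two_mul_le_add_sq ‖f p.1‖ ‖f p.2‖
        have h5 : 0 ≤ √π * A * rexp (-(A * (φ p.1 - φ p.2)) ^ 2 / 4) := by positivity
        nlinarith
    _ ≤ _ := by
        have e1 : AEMeasurable (fun p : X × X ↦ ENNReal.ofReal (‖f p.1‖ ^ 2) * k p.1 p.2)
          (μ.prod μ) := hfm.comp_fst.mul hkm.aemeasurable
        rw [lintegral_const_mul' _ _ ENNReal.ofReal_ne_top, mul_assoc,
          lintegral_const_mul' _ _ (by simp), lintegral_add_left' e1]
        refine mul_le_mul' le_rfl ?_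
        rw [← ENNReal.div_eq_inv_mul]
        refine ENNReal.div_le_of_le_mul ?_
        rw [mul_two]
        exact add_le_add hhalf' hhalf

/-! ### Truncated Dirichlet series for `ζ` -/

open Set in
/-- The remainder integral `∫_N^∞ {v} v^(-s-1) dv`. -/
noncomputable def fractTail (N : ℕ) (s : ℂ) : ℂ :=
  ∫ v in Ioi (N : ℝ), ((Int.fract v : ℝ) : ℂ) * (v : ℂ) ^ (-(s + 1))

open Set in
theorem integrableOn_fract_mul_cpow {N : ℕ} (hN : 0 < N) {s : ℂ} (hs : 0 < s.re) :
    IntegrableOn (fun v : ℝ ↦ ((Int.fract v : ℝ) : ℂ) * (v : ℂ) ^ (-(s + 1))) (Ioi (N : ℝ)) := by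
  have h := integrableOn_Ioi_cpow_of_lt (a := -(s + 1)) (by simp; linarith)
    (show (0 : ℝ) < N by exact_mod_cast hN)
  refine Integrable.mono h (AEStronglyMeasurable.mul ?_ h.aestronglyMeasurable) (.of_forall fun v ↦ ?_)
  · exact (Complex.measurable_ofReal.comp measurable_fract).aestronglyMeasurable
  · rw [norm_mul, Complex.norm_real, Real.norm_of_nonneg (Int.fract_nonneg v)]
    exact mul_le_of_le_one_left (norm_nonneg _) (Int.fract_lt_one v).le

open Set in
theorem norm_fractTail_le {N : ℕ} (hN : 0 < N) {s : ℂ} (hs : 0 < s.re) :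
    ‖fractTail N s‖ ≤ (N : ℝ) ^ (-s.re) / s.re := by
  have hN' : (0 : ℝ) < N := by exact_mod_cast hN
  have h := integrableOn_Ioi_rpow_of_lt (a := -s.re - 1) (by linarith) hN'
  calc ‖fractTail N s‖ ≤ ∫ v in Ioi (N : ℝ), v ^ (-s.re - 1) := by
        refine norm_integral_le_of_norm_le h ?_
        filter_upwards [ae_restrict_mem measurableSet_Ioi] with v hv
        have hv0 : 0 < v := hN'.trans hv
        rw [norm_mul, Complex.norm_real, Real.norm_of_nonneg (Int.fract_nonneg v),
          Complex.norm_cpow_eq_rpow_re_of_pos hv0]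
        refine (mul_le_of_le_one_left (by positivity) (Int.fract_lt_one v).le).trans_eq ?_
        congr 1
        simp; ring
    _ = _ := by
        rw [integral_Ioi_rpow_of_lt (by linarith) hN']
        simp [div_neg, neg_div]

open Set in
/-- The remainder as a Mellin transform, which supplies its holomorphy and its expression as a
Fourier transform. -/
theorem fractTail_eq_mellin (N : ℕ) (s : ℂ) :
    fractTail N s = mellin ((Ioi (N : ℝ)).indicator fun v ↦ ((Int.fract v : ℝ) : ℂ)) (-s) := by
  rw [mellin, fractTail, ← integral_indicator measurableSet_Ioi,
    ← integral_indicator measurableSet_Ioi]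
  congr 1 with v
  by_cases hv : v ∈ Ioi (N : ℝ)
  · have hv0 : v ∈ Ioi (0 : ℝ) := (Nat.cast_nonneg N).trans_lt (mem_Ioi.mp hv)
    rw [indicator_of_mem hv, indicator_of_mem hv0, indicator_of_mem hv, smul_eq_mul, mul_comm]
    congr 2
    ring
  · rw [indicator_of_notMem hv]
    by_cases hv0 : v ∈ Ioi (0 : ℝ)
    · rw [indicator_of_mem hv0, indicator_of_notMem hv, smul_zero]
    · rw [indicator_of_notMem hv0]

open Set Filter Asymptotics in
theorem differentiableAt_fractTail {N : ℕ} (hN : 0 < N) {s : ℂ} (hs : 0 < s.re) :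
    DifferentiableAt ℂ (fractTail N) s := by
  have hN' : (0 : ℝ) < N := by exact_mod_cast hN
  set F : ℝ → ℂ := (Ioi (N : ℝ)).indicator fun v ↦ ((Int.fract v : ℝ) : ℂ) with hF
  have hFle : ∀ v, ‖F v‖ ≤ 1 := by
    intro v
    refine (norm_indicator_le_norm_self _ _).trans ?_
    rw [Complex.norm_real, Real.norm_of_nonneg (Int.fract_nonneg v)]
    exact (Int.fract_lt_one v).le
  have hFm : Measurable F :=
    (Complex.measurable_ofReal.comp measurable_fract).indicator measurableSet_Ioi
  have hd : DifferentiableAt ℂ (mellin F) (-s) := by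
    refine mellin_differentiableAt_of_isBigO_rpow (a := 0) (b := -s.re - 1) ?_ ?_ (by simpa) ?_
      (by simp)
    · refine LocallyIntegrable.locallyIntegrableOn ?_ _
      exact (locallyIntegrable_const (1 : ℝ)).mono hFm.aestronglyMeasurable
        (.of_forall fun v ↦ by simpa using hFle v)
    · simp only [neg_zero, Real.rpow_zero]
      exact IsBigO.of_bound 1 (.of_forall fun v ↦ by simpa using hFle v)
    · refine IsBigO.of_bound 1 ?_
      have : ∀ᶠ v : ℝ in nhdsWithin (0 : ℝ) (Ioi 0), v < N := nhdsWithin_le_nhds (gt_mem_nhds hN')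
      filter_upwards [this] with v hv
      rw [hF, indicator_of_notMem (by simpa using hv.le), norm_zero]
      positivity
  have : fractTail N = mellin F ∘ Neg.neg := funext fun s ↦ fractTail_eq_mellin N s
  rw [this]
  exact hd.comp s differentiable_neg.differentiableAt

open Set Finset in
theorem riemannZeta_eq_sum_add_of_one_lt_re {N : ℕ} (hN : 0 < N) {s : ℂ} (hs : 1 < s.re) :
    riemannZeta s = ∑ n ∈ Finset.Icc 1 N, (n : ℂ) ^ (-s) + (N : ℂ) ^ (1 - s) / (s - 1) -
      s * fractTail N s := by
  classical
  have hN' : (0 : ℝ) < N := by exact_mod_cast hN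
  have hN1 : (1 : ℝ) ≤ N := by exact_mod_cast hN
  -- Abel summation is applied to the tail of the series, whose summatory function is `⌊t⌋ - N`.
  set f : ℕ → ℂ := fun n ↦ if N < n then 1 else 0 with hf
  have hsum : ∀ m : ℕ, ∑ k ∈ Finset.Icc 1 m, f k = ((m - N : ℕ) : ℂ) := by
    intro m
    rw [hf, Finset.sum_ite, Finset.sum_const_zero, add_zero, Finset.sum_const, nsmul_one]
    congr 1
    rw [show {x ∈ Finset.Icc 1 m | N < x} = Finset.Ioc N m by ext; simp; omega, Nat.card_Ioc]
  have hnorm : ∀ n, ‖f n‖ ≤ 1 := fun n ↦ by simp only [hf]; split_ifs <;> simp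
  have hO : (fun n : ℕ ↦ ∑ k ∈ Finset.Icc 1 n, ‖f k‖) =O[Filter.atTop] fun n ↦ (n : ℝ) ^ (1 : ℝ) := by
    refine Asymptotics.IsBigO.of_bound 1 (.of_forall fun n ↦ ?_)
    rw [Real.norm_of_nonneg (Finset.sum_nonneg fun _ _ ↦ norm_nonneg _), Real.rpow_one, one_mul,
      Real.norm_of_nonneg (Nat.cast_nonneg n)]
    refine (Finset.sum_le_sum fun k _ ↦ hnorm k).trans ?_
    simp
  have hfs : LSeriesSummable f s := LSeriesSummable_of_sum_norm_bigO hO zero_le_one hs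
  have h1s : LSeriesSummable 1 s := LSeriesSummable_one_iff.mpr hs
  have hL := LSeries_eq_mul_integral' f zero_le_one hs hO
  have hsplit : riemannZeta s = ∑ n ∈ Finset.Icc 1 N, (n : ℂ) ^ (-s) + LSeries f s := by
    rw [← LSeries_one_eq_riemannZeta hs, ← sub_eq_iff_eq_add, ← LSeries_sub h1s hfs, LSeries,
      tsum_eq_sum (s := Finset.Icc 1 N)]
    · refine Finset.sum_congr rfl fun n hn ↦ ?_
      rw [Finset.mem_Icc] at hn
      rw [LSeries.term_of_ne_zero (by omega)]
      simp [hf, show ¬ N < n by omega, Complex.cpow_neg]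
    · intro n hn
      rw [Finset.mem_Icc] at hn
      rcases Nat.eq_zero_or_pos n with h0 | h0
      · simp [h0]
      · rw [LSeries.term_of_ne_zero h0.ne']
        simp [hf, show N < n by omega]
  have hs1 : s - 1 ≠ 0 := by
    intro h
    have : s = 1 := sub_eq_zero.mp h
    rw [this] at hs; simp at hs
  have hs0 : s ≠ 0 := by rintro rfl; simp at hs; linarith
  have hNc : (N : ℂ) ≠ 0 := by exact_mod_cast hN.ne'
  have i1 := integrableOn_Ioi_cpow_of_lt (a := -s) (by simpa using hs) hN'
  have i2 := integrableOn_Ioi_cpow_of_lt (a := -(s + 1)) (by simp; linarith) hN'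
  have i3 := integrableOn_fract_mul_cpow hN (s := s) (by linarith)
  have hI : ∫ t in Ioi (1 : ℝ), (∑ k ∈ Finset.Icc 1 ⌊t⌋₊, f k) * (t : ℂ) ^ (-(s + 1)) =
      (∫ t in Ioi (N : ℝ), (t : ℂ) ^ (-s)) - N * (∫ t in Ioi (N : ℝ), (t : ℂ) ^ (-(s + 1))) -
        fractTail N s := by
    rw [fractTail, ← integral_const_mul, ← integral_sub i1 (i2.const_mul _),
      ← integral_sub (f := fun t : ℝ ↦ (t : ℂ) ^ (-s) - N * (t : ℂ) ^ (-(s + 1)))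
        (i1.sub (i2.const_mul _)) i3]
    rw [setIntegral_eq_of_subset_of_forall_sdiff_eq_zero measurableSet_Ioi (Ioi_subset_Ioi hN1)]
    · refine setIntegral_congr_fun measurableSet_Ioi fun t ht ↦ ?_
      have ht' : (N : ℝ) < t := ht
      have ht0 : 0 < t := hN'.trans ht'
      have htc : (t : ℂ) ≠ 0 := by exact_mod_cast ht0.ne'
      simp only [hsum]
      rw [Nat.cast_sub (Nat.le_floor ht'.le)]
      have hfl : ((⌊t⌋₊ : ℕ) : ℂ) = t - Int.fract t := by
        have : ((⌊t⌋₊ : ℕ) : ℝ) = t - Int.fract t := by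
          rw [natCast_floor_eq_intCast_floor ht0.le, Int.self_sub_fract]
        exact_mod_cast congrArg (fun x : ℝ ↦ (x : ℂ)) this
      have hpow : (t : ℂ) ^ (-s) = t * (t : ℂ) ^ (-(s + 1)) := by
        rw [neg_add, Complex.cpow_add _ _ htc, Complex.cpow_neg_one]
        field_simp
      rw [hfl, hpow]
      ring
    · intro t ht
      have ht' : t ≤ N := by simpa using ht.2
      have : ⌊t⌋₊ - N = 0 := Nat.sub_eq_zero_of_le (Nat.floor_le_of_le ht')
      rw [hsum, this]; simp
  rw [hsplit, hL, hI, integral_Ioi_cpow_of_lt (by simpa using hs) hN',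
    integral_Ioi_cpow_of_lt (by simp; linarith) hN']
  have e1 : ((N : ℝ) : ℂ) ^ (-s + 1) = (N : ℂ) ^ (1 - s) := by
    rw [Complex.ofReal_natCast]; congr 1; ring
  have e2 : (N : ℂ) * ((N : ℝ) : ℂ) ^ (-(s + 1) + 1) = (N : ℂ) ^ (1 - s) := by
    rw [Complex.ofReal_natCast, show 1 - s = 1 + (-(s + 1) + 1) by ring,
      Complex.cpow_add 1 _ hNc, Complex.cpow_one]
  have e3 : ∀ z : ℂ, (N : ℂ) * (-z / (-(s + 1) + 1)) = (N * z) / s := by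
    intro z; rw [show -(s + 1) + 1 = -s by ring, neg_div_neg_eq]; ring
  rw [e3, e2, e1, show -s + 1 = -(s - 1) by ring, neg_div_neg_eq]
  field_simp
  ring

open Set Filter in
/-- The truncated Dirichlet series in the half-plane `Re s > 0`, multiplied by `s - 1` so that it
holds at `s = 1` as well and continuation takes place in a convex domain. -/
theorem riemannZeta₁_eq {N : ℕ} (hN : 0 < N) {s : ℂ} (hs : 0 < s.re) :
    riemannZeta₁ s = (s - 1) * ∑ n ∈ Finset.Icc 1 N, (n : ℂ) ^ (-s) + (N : ℂ) ^ (1 - s) -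
      s * (s - 1) * fractTail N s := by
  set U : Set ℂ := {z | 0 < z.re} with hU
  have hUo : IsOpen U := isOpen_lt continuous_const Complex.continuous_re
  have hNc : (N : ℂ) ≠ 0 := by exact_mod_cast hN.ne'
  set g : ℂ → ℂ := fun s ↦ (s - 1) * ∑ n ∈ Finset.Icc 1 N, (n : ℂ) ^ (-s) + (N : ℂ) ^ (1 - s) -
      s * (s - 1) * fractTail N s with hg
  have hgd : DifferentiableOn ℂ g U := by
    intro z hz
    refine DifferentiableAt.differentiableWithinAt ?_
    have h1 : DifferentiableAt ℂ (fun s : ℂ ↦ ∑ n ∈ Finset.Icc 1 N, (n : ℂ) ^ (-s)) z := by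
      refine DifferentiableAt.fun_sum fun n hn ↦ ?_
      refine DifferentiableAt.const_cpow (by fun_prop) (Or.inl ?_)
      rw [Finset.mem_Icc] at hn
      exact_mod_cast (by omega : n ≠ 0)
    have h2 : DifferentiableAt ℂ (fun s : ℂ ↦ (N : ℂ) ^ (1 - s)) z :=
      DifferentiableAt.const_cpow (by fun_prop) (Or.inl hNc)
    have h3 := differentiableAt_fractTail hN hz
    fun_prop
  have hgan : AnalyticOnNhd ℂ g U := hgd.analyticOnNhd hUo
  have hzan : AnalyticOnNhd ℂ riemannZeta₁ U :=
    differentiable_riemannZeta₁.differentiableOn.analyticOnNhd hUo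
  have hconn : IsPreconnected U := (convex_halfSpace_re_gt 0).isPreconnected
  refine hzan.eqOn_of_preconnected_of_eventuallyEq hgan hconn (z₀ := 2) (by simp [hU]) ?_ hs
  have hev : ∀ᶠ z : ℂ in nhds 2, 1 < z.re :=
    (isOpen_lt continuous_const Complex.continuous_re).mem_nhds (by simp)
  filter_upwards [hev] with z hz
  have hz1 : z ≠ 1 := by rintro rfl; simp at hz
  have hz1' : z - 1 ≠ 0 := sub_ne_zero.mpr hz1
  have h := riemannZeta_eq_inv_sub_mul hz1
  rw [riemannZeta_eq_sum_add_of_one_lt_re hN hz, eq_inv_mul_iff_mul_eq₀ hz1'] at h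
  rw [← h, hg]
  field_simp

theorem norm_riemannZeta₁_le {s : ℂ} (hs : 1 / 2 ≤ s.re) :
    ‖riemannZeta₁ s‖ ≤ 4 * (1 + ‖s‖) ^ 2 := by
  have hs0 : 0 < s.re := by linarith
  have h1 : ‖s - 1‖ ≤ ‖s‖ + 1 := (norm_sub_le _ _).trans (by simp)
  have h2 : ‖fractTail 1 s‖ ≤ 2 := by
    refine (norm_fractTail_le one_pos hs0).trans ?_
    rw [Nat.cast_one, Real.one_rpow, div_le_iff₀ hs0]
    linarith
  rw [riemannZeta₁_eq one_pos hs0]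
  have h3 : ‖s * (s - 1) * fractTail 1 s‖ ≤ ‖s‖ * (‖s‖ + 1) * 2 := by
    rw [norm_mul, norm_mul]
    gcongr
  have h0 := norm_nonneg s
  calc _ ≤ ‖s - 1‖ + 1 + ‖s * (s - 1) * fractTail 1 s‖ := by
        refine (norm_sub_le _ _).trans ?_
        gcongr
        refine (norm_add_le _ _).trans ?_
        simp
    _ ≤ _ := by nlinarith

/-! ### The mean square of `ζ` to the right of the critical line -/

open Real in
theorem summable_exp_neg_int_sq : Summable fun k : ℤ ↦ rexp (-(k : ℝ) ^ 2 / 4) := by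
  have h : Summable fun k : ℕ ↦ rexp (-(k : ℝ) ^ 2 / 4) := by
    refine Summable.of_nonneg_of_le (fun k ↦ by positivity) (fun k ↦ ?_)
      (Real.summable_exp_nat_mul_iff.mpr (show (-1 / 4 : ℝ) < 0 by norm_num))
    refine exp_le_exp.mpr ?_
    have : (k : ℝ) ≤ k ^ 2 := by exact_mod_cast Nat.le_self_pow two_ne_zero k
    linarith
  refine Summable.of_nat_of_neg (by simpa using h) (by simpa using h)

open Real in
theorem abs_sub_le_mul_abs_log_sub_log {T x y : ℝ} (hx : 0 < x) (hy : 0 < y) (hxT : x ≤ T)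
    (hyT : y ≤ T) : |x - y| ≤ T * |log x - log y| := by
  wlog h : y ≤ x generalizing x y
  · rw [abs_sub_comm, abs_sub_comm (log x)]
    exact this hy hx hyT hxT (le_of_not_ge h)
  have h1 : log y ≤ log x := log_le_log hy h
  rw [abs_of_nonneg (by linarith), abs_of_nonneg (by linarith), ← log_div hx.ne' hy.ne']
  have h2 := one_sub_inv_le_log_of_pos (div_pos hx hy)
  have h3 : 0 ≤ log (x / y) := log_nonneg ((one_le_div hy).mpr h)
  calc x - y = x * (1 - (x / y)⁻¹) := by field_simp
    _ ≤ x * log (x / y) := by gcongr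
    _ ≤ _ := by gcongr

open Real in
theorem sum_exp_neg_sq_log_sub_log_le {N : ℕ} {T : ℝ} (hNT : (N : ℝ) ≤ T) {n : ℕ}
    (hn : n ∈ Finset.Icc 1 N) :
    ∑ m ∈ Finset.Icc 1 N, rexp (-(T * (log m - log n)) ^ 2 / 4) ≤
      ∑' k : ℤ, rexp (-(k : ℝ) ^ 2 / 4) := by
  rw [Finset.mem_Icc] at hn
  have hle : ∀ m ∈ Finset.Icc 1 N, rexp (-(T * (log m - log n)) ^ 2 / 4) ≤
      rexp (-(((m - n : ℤ)) : ℝ) ^ 2 / 4) := by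
    intro m hm
    rw [Finset.mem_Icc] at hm
    have hmN : (m : ℝ) ≤ N := by exact_mod_cast hm.2
    have hnN : (n : ℝ) ≤ N := by exact_mod_cast hn.2
    have := abs_sub_le_mul_abs_log_sub_log (T := T) (x := m) (y := n) (by exact_mod_cast hm.1)
      (by exact_mod_cast hn.1) (hmN.trans hNT) (hnN.trans hNT)
    have hT : 0 ≤ T := (Nat.cast_nonneg N).trans hNT
    rw [← abs_of_nonneg hT, ← abs_mul] at this
    refine exp_le_exp.mpr ?_
    have h2 := sq_le_sq.mpr this
    push_cast
    linarith
  refine (Finset.sum_le_sum hle).trans ?_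
  have hinj : Set.InjOn (fun m : ℕ ↦ (m - n : ℤ)) (Finset.Icc 1 N) := fun a _ b _ h ↦ by
    simp only at h; omega
  rw [← Finset.sum_image (g := fun m : ℕ ↦ (m - n : ℤ)) (f := fun k : ℤ ↦ rexp (-(k : ℝ) ^ 2 / 4))
    hinj]
  exact summable_exp_neg_int_sq.sum_le_tsum _ fun k _ ↦ by positivity

open Real in
/-- For `n ≤ N ≤ T` the frequencies `log n` are separated by at least `1 / T`, which bounds the
Gaussian kernel in Schur's test. -/
theorem lintegral_normSq_sum_cpow_le {N : ℕ} {T σ : ℝ} (hT : 0 < T) (hNT : (N : ℝ) ≤ T)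
    (hσ : 1 / 2 ≤ σ) :
    ∫⁻ t : ℝ, ENNReal.ofReal
        (‖∑ n ∈ Finset.Icc 1 N, (n : ℂ) ^ (-((σ : ℂ) + t * Complex.I))‖ ^ 2 *
          rexp (-(t / T) ^ 2)) ≤
      ENNReal.ofReal (√π * T * (∑' k : ℤ, rexp (-(k : ℝ) ^ 2 / 4)) * (1 + log N)) := by
  set S := ∑' k : ℤ, rexp (-(k : ℝ) ^ 2 / 4) with hS
  have hS0 : 0 ≤ S := tsum_nonneg fun k ↦ by positivity
  have h := lintegral_normSq_integral_cexp_mul_gaussian_le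
    (X := Finset.Icc 1 N) (μ := Measure.count) (f := fun n ↦ ((((n : ℕ) : ℝ) ^ (-σ) : ℝ) : ℂ))
    (φ := fun n ↦ log ((n : ℕ) : ℝ)) .of_finite (measurable_of_finite _) hT
    (K := ENNReal.ofReal S) ?_
  · simp only [integral_count, lintegral_fintype] at h
    simp only [Measure.count_singleton, mul_one] at h
    have hterm : ∀ t : ℝ, ∑ n : Finset.Icc 1 N, ((((n : ℕ) : ℝ) ^ (-σ) : ℝ) : ℂ) *
        Complex.exp (-(Complex.I * t * log ((n : ℕ) : ℝ))) =
        ∑ n ∈ Finset.Icc 1 N, (n : ℂ) ^ (-((σ : ℂ) + t * Complex.I)) := by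
      intro t
      rw [← Finset.sum_coe_sort (Finset.Icc 1 N)]
      refine Finset.sum_congr rfl fun n _ ↦ ?_
      have hn : 0 < (n : ℕ) := (Finset.mem_Icc.mp n.2).1
      have hnc : (((n : ℕ)) : ℂ) ≠ 0 := by exact_mod_cast hn.ne'
      rw [neg_add, Complex.cpow_add _ _ hnc, Complex.ofReal_cpow (Nat.cast_nonneg _)]
      congr 1
      · push_cast; rfl
      · rw [Complex.cpow_def_of_ne_zero hnc, Complex.natCast_log]
        congr 1
        ring
    simp only [hterm] at h
    refine h.trans ?_
    rw [← ENNReal.ofReal_mul (by positivity), ← ENNReal.ofReal_sum_of_nonneg fun _ _ ↦ by positivity,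
      ← ENNReal.ofReal_mul (by positivity)]
    refine ENNReal.ofReal_le_ofReal (mul_le_mul_of_nonneg_left ?_ (by positivity))
    calc _ ≤ ∑ n : Finset.Icc 1 N, (((n : ℕ)) : ℝ)⁻¹ := by
          refine Finset.sum_le_sum fun n _ ↦ ?_
          have hn : (1 : ℝ) ≤ (n : ℕ) := by exact_mod_cast (Finset.mem_Icc.mp n.2).1
          rw [Complex.norm_real, norm_of_nonneg (by positivity), ← rpow_natCast, ← rpow_mul (by positivity),
            ← rpow_neg_one]
          refine rpow_le_rpow_of_exponent_le hn ?_
          push_cast; linarith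
      _ = ((harmonic N : ℚ) : ℝ) := by
          rw [Finset.sum_coe_sort (Finset.Icc 1 N) (fun n : ℕ ↦ ((n : ℝ))⁻¹), harmonic_eq_sum_Icc]
          push_cast; rfl
      _ ≤ _ := harmonic_le_one_add_log N
  · intro y
    rw [lintegral_fintype]
    simp only [Measure.count_singleton, mul_one]
    rw [← ENNReal.ofReal_sum_of_nonneg fun _ _ ↦ by positivity]
    refine ENNReal.ofReal_le_ofReal ?_
    rw [Finset.sum_coe_sort (Finset.Icc 1 N)
      (fun m : ℕ ↦ rexp (-(T * (log m - log ((y : ℕ) : ℝ))) ^ 2 / 4))]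
    exact sum_exp_neg_sq_log_sub_log_le hNT y.2

open Real Set in
/-- The bound is independent of `T`: the saving over the trivial estimate `T / N` is what makes
`N ≈ T` an admissible length. -/
theorem lintegral_normSq_fractTail_le {N : ℕ} (hN : 0 < N) {T σ : ℝ} (hT : 0 < T)
    (hσ : 1 / 2 ≤ σ) :
    ∫⁻ t : ℝ, ENNReal.ofReal (‖fractTail N ((σ : ℂ) + t * Complex.I)‖ ^ 2 *
          rexp (-(t / T) ^ 2)) ≤ ENNReal.ofReal (2 * π / N) := by
  have hN1 : (1 : ℝ) ≤ N := by exact_mod_cast hN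
  have hN' : (0 : ℝ) < N := by linarith
  set F : ℝ → ℂ := (Ioi (N : ℝ)).indicator fun v ↦ ((Int.fract v : ℝ) : ℂ) with hF
  have hFm : Measurable F :=
    (Complex.measurable_ofReal.comp measurable_fract).indicator measurableSet_Ioi
  have hFle : ∀ u : ℝ, ‖F (rexp (-u))‖ ≤ (Iic (-log N)).indicator 1 u := by
    intro u
    by_cases hu : u ∈ Iic (-log N)
    · rw [indicator_of_mem hu]
      refine (norm_indicator_le_norm_self _ _).trans ?_
      rw [Complex.norm_real, Real.norm_of_nonneg (Int.fract_nonneg _)]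
      exact (Int.fract_lt_one _).le
    · rw [indicator_of_notMem hu, hF, indicator_of_notMem, norm_zero]
      simp only [mem_Iic, not_le, mem_Ioi, not_lt] at hu ⊢
      rw [← le_log_iff_exp_le hN']
      linarith
  set f : ℝ → ℂ := fun u ↦ rexp (σ * u) • F (rexp (-u)) with hf
  have hfm : Measurable f := by
    have : Measurable fun u ↦ F (rexp (-u)) := hFm.comp (by fun_prop)
    exact Measurable.smul (f := fun u ↦ rexp (σ * u)) (by fun_prop) this
  have hfle : ∀ u, ‖f u‖ ≤ (Iic (-log N)).indicator (fun u ↦ rexp (σ * u)) u := by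
    intro u
    rw [hf, norm_smul, norm_of_nonneg (exp_pos _).le]
    refine (mul_le_mul_of_nonneg_left (hFle u) (exp_pos _).le).trans_eq ?_
    by_cases hu : u ∈ Iic (-log N) <;> simp [hu]
  have hfint : Integrable f := by
    refine Integrable.mono' ?_ hfm.aestronglyMeasurable (.of_forall hfle)
    rw [integrable_indicator_iff measurableSet_Iic]
    exact integrableOn_exp_mul_Iic (by linarith) _
  have h := lintegral_normSq_integral_cexp_mul_gaussian_le (μ := volume) (f := f)
    (φ := fun u ↦ -u) hfint measurable_neg hT (K := ENNReal.ofReal (2 * √π / T)) ?_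
  · have hterm : ∀ t : ℝ, ∫ u, f u * Complex.exp (-(Complex.I * t * ((-u : ℝ) : ℂ))) =
        fractTail N ((σ : ℂ) + t * Complex.I) := by
      intro t
      rw [fractTail_eq_mellin, mellin_eq_fourier, Real.fourier_real_eq_integral_exp_smul]
      congr 1 with u
      rw [smul_eq_mul, mul_comm]
      have e : 2 * π * u * (t / (2 * π)) = u * t := by field_simp
      congr 1
      · congr 1
        simp
        have := congrArg (fun x : ℝ ↦ (x : ℂ)) e
        push_cast at this
        linear_combination (-Complex.I) * this
      · simp [hf, hF]
    simp only [hterm] at h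
    refine h.trans ?_
    have h2 : ∫⁻ u, ENNReal.ofReal (‖f u‖ ^ 2) ≤ ENNReal.ofReal (1 / N) := by
      calc _ ≤ ∫⁻ u in Iic (-log N), ENNReal.ofReal (rexp (1 * u)) := by
            rw [← lintegral_indicator measurableSet_Iic]
            refine lintegral_mono fun u ↦ ?_
            by_cases hu : u ∈ Iic (-log N)
            · rw [indicator_of_mem hu]
              refine ENNReal.ofReal_le_ofReal ?_
              have := hfle u
              rw [indicator_of_mem hu] at this
              refine (pow_le_pow_left₀ (norm_nonneg _) this 2).trans ?_
              rw [← exp_nat_mul]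
              refine exp_le_exp.mpr ?_
              have hu0 : u ≤ 0 := (mem_Iic.mp hu).trans (by linarith [log_nonneg hN1])
              push_cast
              nlinarith
            · have := hfle u
              rw [indicator_of_notMem hu] at this
              rw [le_antisymm this (norm_nonneg _)]
              simp
        _ = _ := by
            rw [← ofReal_integral_eq_lintegral_ofReal (integrableOn_exp_mul_Iic one_pos _)
              (.of_forall fun u ↦ (exp_pos _).le), integral_exp_mul_Iic one_pos]
            rw [one_mul, exp_neg, exp_log hN', div_one, one_div]
    refine (mul_le_mul' le_rfl h2).trans ?_
    rw [← ENNReal.ofReal_mul (by positivity), ← ENNReal.ofReal_mul (by positivity)]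
    refine ENNReal.ofReal_le_ofReal (le_of_eq ?_)
    have : √π * √π = π := mul_self_sqrt pi_pos.le
    field_simp
    linear_combination this
  · intro y
    have hg := integrable_exp_neg_mul_sq (b := T ^ 2 / 4) (by positivity)
    have e : ∀ x : ℝ, rexp (-(T * (-x - -y)) ^ 2 / 4) = rexp (-(T ^ 2 / 4) * (x - y) ^ 2) := by
      intro x; congr 1; ring
    simp only [e]
    rw [lintegral_sub_right_eq_self (fun x ↦ ENNReal.ofReal (rexp (-(T ^ 2 / 4) * x ^ 2))),
      ← ofReal_integral_eq_lintegral_ofReal hg (.of_forall fun u ↦ (exp_pos _).le),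
      integral_gaussian]
    refine ENNReal.ofReal_le_ofReal (le_of_eq ?_)
    rw [show π / (T ^ 2 / 4) = π * (2 / T) ^ 2 by field_simp; norm_num, sqrt_mul pi_pos.le,
      sqrt_sq (by positivity)]
    ring

open Real Set in
theorem norm_riemannZeta₁_sq_le {N : ℕ} (hN : 0 < N) {σ T t : ℝ} (hNT : (N : ℝ) ≤ T)
    (hσ : 1 / 2 ≤ σ) (hσT : σ ≤ T) (hT : 1 ≤ T) (ht0 : 0 ≤ t) (ht : t ≤ 3 * T) :
    ‖riemannZeta₁ ((σ : ℂ) + t * Complex.I)‖ ^ 2 ≤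
      75 * T ^ 2 * ‖∑ n ∈ Finset.Icc 1 N, (n : ℂ) ^ (-((σ : ℂ) + t * Complex.I))‖ ^ 2 + 3 * T +
        1875 * T ^ 4 * ‖fractTail N ((σ : ℂ) + t * Complex.I)‖ ^ 2 := by
  have hN1 : (1 : ℝ) ≤ N := by exact_mod_cast hN
  set s : ℂ := (σ : ℂ) + t * Complex.I with hs
  have hsre : s.re = σ := by simp [hs]
  have hsn : ‖s‖ ≤ 4 * T := by
    refine (norm_add_le _ _).trans ?_
    rw [norm_mul, Complex.norm_I, mul_one, Complex.norm_real, Complex.norm_real,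
      norm_of_nonneg ht0, norm_of_nonneg (by linarith)]
    linarith
  have hs1 : ‖s - 1‖ ≤ 5 * T := (norm_sub_le _ _).trans (by rw [norm_one]; linarith)
  have hNs : ‖(N : ℂ) ^ (1 - s)‖ ^ 2 ≤ T := by
    rw [← Complex.ofReal_natCast, Complex.norm_cpow_eq_rpow_re_of_pos (by linarith),
      ← rpow_natCast, ← rpow_mul (by linarith)]
    refine (rpow_le_rpow_of_exponent_le hN1 (z := 1) ?_).trans (by simpa using hNT)
    simp [hsre]; linarith
  rw [riemannZeta₁_eq hN (by rw [hsre]; linarith)]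
  set D := ∑ n ∈ Finset.Icc 1 N, (n : ℂ) ^ (-s)
  set R := fractTail N s
  set E := (N : ℂ) ^ (1 - s)
  have h1 : ‖(s - 1) * D + E - s * (s - 1) * R‖ ≤ 5 * T * ‖D‖ + ‖E‖ + 25 * T ^ 2 * ‖R‖ := by
    refine (norm_sub_le _ _).trans (add_le_add ((norm_add_le _ _).trans ?_) ?_)
    · rw [norm_mul]; gcongr
    · rw [norm_mul, norm_mul]
      refine mul_le_mul_of_nonneg_right ?_ (norm_nonneg _)
      calc ‖s‖ * ‖s - 1‖ ≤ (5 * T) * (5 * T) := by gcongr; linarith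
        _ = _ := by ring
  have h2 := pow_le_pow_left₀ (norm_nonneg _) h1 2
  have h3 : ∀ a b c : ℝ, (a + b + c) ^ 2 ≤ 3 * a ^ 2 + 3 * b ^ 2 + 3 * c ^ 2 := fun a b c ↦ by
    nlinarith [sq_nonneg (a - b), sq_nonneg (b - c), sq_nonneg (a - c)]
  calc _ ≤ _ := h2
    _ ≤ _ := h3 _ _ _
    _ ≤ _ := by nlinarith

open Real Set in
/-- The mean square bound for `ζ₁` on `[T / 2, 3 T]`; one factor `T ^ 2` of the right-hand side
comes from `|s - 1| ^ 2`. The range exceeds `[T, 2T]` to leave room for vertical shifts. -/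
theorem exists_lintegral_normSq_riemannZeta₁_le :
    ∃ C : ℝ, 0 < C ∧ ∀ T : ℝ, 3 ≤ T → ∀ σ : ℝ, 1 / 2 ≤ σ → σ ≤ T →
      ∫⁻ t in Icc (T / 2) (3 * T), ENNReal.ofReal (‖riemannZeta₁ ((σ : ℂ) + t * Complex.I)‖ ^ 2) ≤
        ENNReal.ofReal (C * T ^ 3 * log T) := by
  set S := ∑' k : ℤ, rexp (-(k : ℝ) ^ 2 / 4) with hS
  have hS0 : 0 ≤ S := tsum_nonneg fun k ↦ by positivity
  refine ⟨rexp 9 * (150 * √π * S) + 9 + 7500 * rexp 9 * π, by positivity, ?_⟩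
  intro T hT σ hσ hσT
  -- The length `N ≈ T` balances the Dirichlet polynomial against the remainder.
  set N := ⌊T⌋₊ with hNdef
  have hT0 : 0 < T := by linarith
  have hN : 0 < N := Nat.floor_pos.mpr (by linarith)
  have hNT : (N : ℝ) ≤ T := Nat.floor_le hT0.le
  have hNT2 : T / 2 ≤ N := by
    have := Nat.lt_floor_add_one T
    linarith
  have hN1 : (1 : ℝ) ≤ N := by exact_mod_cast hN
  have hlogT : 1 ≤ log T := by
    rw [le_log_iff_exp_le hT0]
    linarith [exp_one_lt_d9]
  have hlogN : 1 + log N ≤ 2 * log T := by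
    have := log_le_log (by linarith) hNT
    linarith
  set D : ℝ → ENNReal := fun t ↦ ENNReal.ofReal
        (‖∑ n ∈ Finset.Icc 1 N, (n : ℂ) ^ (-((σ : ℂ) + t * Complex.I))‖ ^ 2 *
          rexp (-(t / T) ^ 2)) with hD
  set R : ℝ → ENNReal := fun t ↦ ENNReal.ofReal (‖fractTail N ((σ : ℂ) + t * Complex.I)‖ ^ 2 *
          rexp (-(t / T) ^ 2)) with hR
  have hDm : Measurable D := by
    refine ENNReal.measurable_ofReal.comp (Continuous.measurable ?_)
    refine Continuous.mul (Continuous.pow (Continuous.norm ?_) 2) (by fun_prop)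
    refine continuous_finsetSum _ fun n hn ↦ ?_
    rw [Finset.mem_Icc] at hn
    have : (n : ℂ) ≠ 0 := by exact_mod_cast (by omega : n ≠ 0)
    exact Continuous.const_cpow (by fun_prop) (Or.inl this)
  have hpt : ∀ t ∈ Icc (T / 2) (3 * T),
      ENNReal.ofReal (‖riemannZeta₁ ((σ : ℂ) + t * Complex.I)‖ ^ 2) ≤
      ENNReal.ofReal (75 * T ^ 2 * rexp 9) * D t + (ENNReal.ofReal (3 * T) +
        ENNReal.ofReal (1875 * T ^ 4 * rexp 9) * R t) := by
    intro t ht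
    -- On the range of integration `t / T ≤ 3`, so the Gaussian weight is at least `exp (-9)`.
    have hw : 1 ≤ rexp 9 * rexp (-(t / T) ^ 2) := by
      rw [← exp_add]
      refine one_le_exp ?_
      have h1 : t / T ≤ 3 := by rw [div_le_iff₀ hT0]; exact ht.2
      have h2 : 0 ≤ t / T := div_nonneg (by linarith [ht.1]) hT0.le
      nlinarith
    rw [hD, hR]
    simp only
    rw [← ENNReal.ofReal_mul (by positivity), ← ENNReal.ofReal_mul (by positivity),
      ← ENNReal.ofReal_add (by positivity) (by positivity),
      ← ENNReal.ofReal_add (by positivity) (by positivity)]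
    refine ENNReal.ofReal_le_ofReal ?_
    refine (norm_riemannZeta₁_sq_le hN hNT hσ hσT (by linarith) (by linarith [ht.1]) ht.2).trans ?_
    rw [add_assoc]
    refine add_le_add ?_ (add_le_add le_rfl ?_)
    · calc _ ≤ (75 * T ^ 2 *
          ‖∑ n ∈ Finset.Icc 1 N, (n : ℂ) ^ (-((σ : ℂ) + t * Complex.I))‖ ^ 2) *
            (rexp 9 * rexp (-(t / T) ^ 2)) := le_mul_of_one_le_right (by positivity) hw
        _ = _ := by ring
    · calc _ ≤ (1875 * T ^ 4 * ‖fractTail N ((σ : ℂ) + t * Complex.I)‖ ^ 2) *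
            (rexp 9 * rexp (-(t / T) ^ 2)) := le_mul_of_one_le_right (by positivity) hw
        _ = _ := by ring
  calc _ ≤ ∫⁻ t in Icc (T / 2) (3 * T), (ENNReal.ofReal (75 * T ^ 2 * rexp 9) * D t +
        (ENNReal.ofReal (3 * T) + ENNReal.ofReal (1875 * T ^ 4 * rexp 9) * R t)) :=
        setLIntegral_mono' measurableSet_Icc hpt
    _ = ENNReal.ofReal (75 * T ^ 2 * rexp 9) * (∫⁻ t in Icc (T / 2) (3 * T), D t) +
        (ENNReal.ofReal (3 * T) * ENNReal.ofReal (3 * T - T / 2) +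
        ENNReal.ofReal (1875 * T ^ 4 * rexp 9) * ∫⁻ t in Icc (T / 2) (3 * T), R t) := by
        rw [lintegral_add_left (hDm.const_mul _), lintegral_add_left measurable_const,
          lintegral_const_mul' _ _ ENNReal.ofReal_ne_top,
          lintegral_const_mul' _ _ ENNReal.ofReal_ne_top]
        simp
    _ ≤ ENNReal.ofReal (75 * T ^ 2 * rexp 9) * ENNReal.ofReal (√π * T * S * (1 + log N)) +
        (ENNReal.ofReal (3 * T) * ENNReal.ofReal (3 * T - T / 2) +
        ENNReal.ofReal (1875 * T ^ 4 * rexp 9) * ENNReal.ofReal (2 * π / N)) := by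
        gcongr
        · exact (setLIntegral_le_lintegral _ _).trans
            (lintegral_normSq_sum_cpow_le hT0 hNT hσ)
        · exact (setLIntegral_le_lintegral _ _).trans (lintegral_normSq_fractTail_le hN hT0 hσ)
    _ ≤ _ := by
        have hlN := log_nonneg hN1
        have e1 : 0 ≤ 3 * T - T / 2 := by linarith
        rw [← ENNReal.ofReal_mul (by positivity), ← ENNReal.ofReal_mul (by positivity),
          ← ENNReal.ofReal_mul (by positivity), ← ENNReal.ofReal_add (by positivity) (by positivity),
          ← ENNReal.ofReal_add (by positivity) (by positivity)]
        refine ENNReal.ofReal_le_ofReal ?_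
        have a1 : 75 * T ^ 2 * rexp 9 * (√π * T * S * (1 + log N)) ≤
            rexp 9 * (150 * √π * S) * T ^ 3 * log T := by
          calc _ = 75 * rexp 9 * √π * S * T ^ 3 * (1 + log N) := by ring
            _ ≤ 75 * rexp 9 * √π * S * T ^ 3 * (2 * log T) := by gcongr
            _ = _ := by ring
        have a2 : 3 * T * (3 * T - T / 2) ≤ 9 * T ^ 3 * log T := by
          calc _ ≤ 9 * T ^ 2 * (1 * 1) := by nlinarith
            _ ≤ 9 * T ^ 2 * (T * log T) := by gcongr; linarith
            _ = _ := by ring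
        have a3 : 1875 * T ^ 4 * rexp 9 * (2 * π / N) ≤ 7500 * rexp 9 * π * T ^ 3 * log T := by
          calc _ ≤ 1875 * T ^ 4 * rexp 9 * (2 * π / (T / 2)) * 1 := by rw [mul_one]; gcongr
            _ ≤ 1875 * T ^ 4 * rexp 9 * (2 * π / (T / 2)) * log T := by gcongr
            _ = _ := by field_simp; ring
        nlinarith

/-! ### Pointwise bounds for `ζ` outside an event of small probability -/

open Real Set in
/-- Large values of `ζ₁` on a vertical segment are rare. At a point of the segment `‖ζ₁‖ ^ 2` is
at most its average over a disc of radius `r`, and the expectation of the area integral over the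
`r`-neighbourhood of the segment is controlled by the mean square. -/
theorem exists_uniformLaw_norm_riemannZeta₁_le :
    ∃ C : ℝ, 0 < C ∧ ∀ T σ r U M : ℝ, 3 ≤ T → 0 < r → r ≤ 1 → 1 / 2 ≤ σ - r → σ + r ≤ T →
      0 ≤ U → U + 1 ≤ T / 2 → 0 < M →
      uniformLaw T {τ | ∃ u ∈ Icc (-U) U, M < ‖riemannZeta₁ (σ + (τ + u : ℝ) * Complex.I)‖ ^ 2} ≤
        ENNReal.ofReal (C * T ^ 2 * log T * (U + 1) / (r * M)) := by
  obtain ⟨C, hC, hms⟩ := exists_lintegral_normSq_riemannZeta₁_le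
  refine ⟨4 * C, by positivity, ?_⟩
  intro T σ r U M hT hr hr1 hσ hσT hU hUT hM
  have hT0 : 0 < T := by linarith
  have hlog : 0 ≤ log T := log_nonneg (by linarith)
  set g : ℝ → ℝ → ENNReal := fun x t ↦
    ENNReal.ofReal (‖riemannZeta₁ ((x : ℂ) + t * Complex.I)‖ ^ 2) with hg
  have hgm : Measurable (Function.uncurry g) := by
    refine ENNReal.measurable_ofReal.comp (Continuous.measurable ?_)
    exact ((differentiable_riemannZeta₁.continuous.comp (by fun_prop)).norm.pow 2)
  set ν : Measure (ℝ × ℝ) := (volume.restrict (Icc (σ - r) (σ + r))).prod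
    (volume.restrict (Icc (-(U + 1)) (U + 1))) with hν
  set A : ℝ → ENNReal := fun τ ↦ ∫⁻ p, g p.1 (τ + p.2) ∂ν with hA
  have hgm3 : Measurable (Function.uncurry fun (τ : ℝ) (p : ℝ × ℝ) ↦ g p.1 (τ + p.2)) :=
    hgm.comp (f := fun q : ℝ × ℝ × ℝ ↦ (q.2.1, q.1 + q.2.2)) (by fun_prop)
  have hAm : Measurable A := hgm3.lintegral_prod_right'
  have hsub : {τ | ∃ u ∈ Icc (-U) U, M < ‖riemannZeta₁ (σ + (τ + u : ℝ) * Complex.I)‖ ^ 2} ⊆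
      {τ | ENNReal.ofReal (π * r ^ 2 * M) ≤ A τ} := by
    rintro τ ⟨u, hu, hMu⟩
    have h := ofReal_mul_norm_rpow_le_lintegral_square differentiable_riemannZeta₁
      (two_pos : (0 : ℝ) < 2) σ (τ + u) hr
    simp only [rpow_ofNat] at h
    rw [mem_ofPred_eq, ENNReal.ofReal_mul (by positivity)]
    refine (mul_le_mul' le_rfl (ENNReal.ofReal_le_ofReal hMu.le)).trans (h.trans ?_)
    have hm1 : Measurable fun p : ℝ × ℝ ↦ g p.1 (τ + p.2) :=
      hgm.comp (f := fun p : ℝ × ℝ ↦ (p.1, τ + p.2)) (by fun_prop)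
    simp only [hA, hν]
    rw [lintegral_prod _ hm1.aemeasurable]
    refine lintegral_mono fun x ↦ ?_
    simp only
    rw [← lintegral_indicator measurableSet_Icc, ← lintegral_indicator measurableSet_Icc,
      ← lintegral_add_left_eq_self _ τ]
    refine lintegral_mono fun v ↦ ?_
    by_cases hv : τ + v ∈ Icc (τ + u - r) (τ + u + r)
    · have hv2 : v ∈ Icc (-(U + 1)) (U + 1) :=
        ⟨by linarith [hv.1, hu.1], by linarith [hv.2, hu.2]⟩
      rw [indicator_of_mem hv, indicator_of_mem hv2]
    · rw [indicator_of_notMem hv]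
      exact zero_le
  have hint : ∫⁻ τ in Icc T (2 * T), A τ ≤
      ENNReal.ofReal (C * T ^ 3 * log T * (2 * r * (2 * (U + 1)))) := by
    simp only [hA]
    rw [lintegral_lintegral_swap hgm3.aemeasurable]
    have hin : ∀ᵐ p ∂ν, ∫⁻ τ in Icc T (2 * T), g p.1 (τ + p.2) ≤
        ENNReal.ofReal (C * T ^ 3 * log T) := by
      rw [hν, Measure.prod_restrict]
      filter_upwards [ae_restrict_mem (measurableSet_Icc.prod measurableSet_Icc)] with p hp
      refine le_trans ?_ (hms T hT p.1 (by linarith [hp.1.1]) (by linarith [hp.1.2]))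
      rw [← lintegral_indicator measurableSet_Icc, ← lintegral_indicator measurableSet_Icc,
        ← lintegral_add_right_eq_self (fun t ↦ (Icc (T / 2) (3 * T)).indicator _ t) p.2]
      refine lintegral_mono fun τ ↦ ?_
      by_cases hτ : τ ∈ Icc T (2 * T)
      · have : τ + p.2 ∈ Icc (T / 2) (3 * T) :=
          ⟨by linarith [hτ.1, hp.2.1], by linarith [hτ.2, hp.2.2]⟩
        rw [indicator_of_mem hτ, indicator_of_mem this]
      · rw [indicator_of_notMem hτ]
        exact zero_le
    refine (lintegral_mono_ae hin).trans ?_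
    rw [lintegral_const, hν, ← univ_prod_univ, Measure.prod_prod, Measure.restrict_apply_univ,
      Measure.restrict_apply_univ, volume_Icc, volume_Icc, ← ENNReal.ofReal_mul (by linarith),
      ← ENNReal.ofReal_mul (by positivity)]
    refine ENNReal.ofReal_le_ofReal (le_of_eq ?_)
    ring
  have hmarkov := (mul_meas_ge_le_lintegral (μ := volume.restrict (Icc T (2 * T))) hAm
    (ENNReal.ofReal (π * r ^ 2 * M))).trans hint
  have hq : 0 < π * r ^ 2 * M := by positivity
  rw [mul_comm, ← ENNReal.le_div_iff_mul_le (Or.inl (by simpa using hq))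
    (Or.inl ENNReal.ofReal_ne_top), ← ENNReal.ofReal_div_of_pos hq] at hmarkov
  rw [uniformLaw, ProbabilityTheory.cond, Measure.smul_apply, smul_eq_mul, volume_Icc,
    ← ENNReal.ofReal_inv_of_pos (by linarith)]
  refine (mul_le_mul' le_rfl ((measure_mono hsub).trans hmarkov)).trans ?_
  rw [← ENNReal.ofReal_mul (by rw [inv_nonneg]; linarith)]
  refine ENNReal.ofReal_le_ofReal ?_
  calc _ = (4 * C * T ^ 2 * log T * (U + 1) / (r * M)) / π := by
        rw [show 2 * T - T = T by ring]; field_simp; ring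
    _ ≤ _ := div_le_self (by positivity) (by linarith [pi_gt_three])

/-! ### The localized zeta function -/

open Real in
/-- The entire function whose `β`-th moments on vertical lines are compared: `ζ₁` translated to the
point `1/2 + iτ`, cut off by `exp (-cos (κ z) / cosh (κ H))` and tilted by `exp (-μ z / β)`. -/
noncomputable def localizedZeta (β τ κ H μ : ℝ) (z : ℂ) : ℂ :=
  riemannZeta₁ (1 / 2 + τ * Complex.I + z) *
    Complex.exp (-((1 / cosh (κ * H) : ℝ) * Complex.cos (κ * z))) * Complex.exp (-(μ / β * z))

theorem differentiable_localizedZeta (β τ κ H μ : ℝ) :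
    Differentiable ℂ (localizedZeta β τ κ H μ) := by
  have : Differentiable ℂ fun z : ℂ ↦ riemannZeta₁ (1 / 2 + τ * Complex.I + z) :=
    differentiable_riemannZeta₁.comp (by fun_prop)
  unfold localizedZeta
  fun_prop

open Real in
theorem norm_localizedZeta_rpow {β : ℝ} (hβ : 0 < β) (τ κ H μ x y : ℝ) :
    ‖localizedZeta β τ κ H μ (x + y * Complex.I)‖ ^ β =
      ‖riemannZeta₁ ((1 / 2 + x : ℝ) + (τ + y : ℝ) * Complex.I)‖ ^ β *
        rexp (-(β * (cos (κ * x) * (cosh (κ * y) / cosh (κ * H))))) * rexp (-(μ * x)) := by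
  have hcos : (Complex.cos (κ * (x + y * Complex.I))).re = cos (κ * x) * cosh (κ * y) := by
    rw [show (κ : ℂ) * (x + y * Complex.I) = ((κ * x : ℝ) : ℂ) + ((κ * y : ℝ) : ℂ) * Complex.I by
      push_cast; ring, Complex.cos_add_mul_I, ← Complex.ofReal_cos, ← Complex.ofReal_cosh,
      ← Complex.ofReal_sin, ← Complex.ofReal_sinh]
    simp only [Complex.sub_re, Complex.mul_re, Complex.mul_im, Complex.ofReal_re,
      Complex.ofReal_im, Complex.I_re, Complex.I_im]
    ring
  rw [localizedZeta, norm_mul, norm_mul, mul_rpow (by positivity) (by positivity),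
    mul_rpow (by positivity) (by positivity), Complex.norm_exp, Complex.norm_exp,
    ← exp_mul, ← exp_mul]
  congr 2
  · congr 3
    push_cast; ring
  · congr 1
    rw [Complex.neg_re, Complex.re_ofReal_mul, hcos]
    ring
  · rw [Complex.neg_re, ← Complex.ofReal_div, Complex.re_ofReal_mul]
    simp
    field_simp

open Real Set in
/-- The upper bound used on both edges of the strip: the cut-off is at most `1`, and outside
`[-2H, 2H]` the hypothesis `htail` takes over. As `κ x ≤ 1`, the factor `cos (κ x)` in the exponent
is at least `1 / 2`. -/
theorem integral_localizedZeta_le {β Δ H κ μ τ D : ℝ} (hβ : 0 < β) (hH : 0 < H)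
    (hκ : 0 ≤ κ) (hκΔ : κ * Δ ≤ 1) (hD : 0 ≤ D)
    (htail : ∀ x ∈ Icc 0 Δ, ∀ y : ℝ, 2 * H ≤ |y| →
      ‖riemannZeta₁ ((1 / 2 + x : ℝ) + (τ + y : ℝ) * Complex.I)‖ ^ β *
        rexp (-(β / 2 * (cosh (κ * y) / cosh (κ * H)))) ≤ D / (1 + y ^ 2))
    {x : ℝ} (hx : x ∈ Icc 0 Δ) :
    ∫ y : ℝ, ‖localizedZeta β τ κ H μ (x + y * Complex.I)‖ ^ β ≤
      rexp (-(μ * x)) * ((∫ y in (-(2 * H))..(2 * H),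
        ‖riemannZeta₁ ((1 / 2 + x : ℝ) + (τ + y : ℝ) * Complex.I)‖ ^ β) + D * π) := by
  have hcos : 1 / 2 ≤ cos (κ * x) := by
    have h0 : 0 ≤ κ * x := mul_nonneg hκ hx.1
    have h1 : κ * x ≤ 1 := (mul_le_mul_of_nonneg_left hx.2 hκ).trans hκΔ
    have := one_sub_sq_div_two_le_cos (x := κ * x)
    nlinarith
  have hζ : Continuous fun y : ℝ ↦
      ‖riemannZeta₁ ((1 / 2 + x : ℝ) + (τ + y : ℝ) * Complex.I)‖ ^ β :=
    ((differentiable_riemannZeta₁.continuous.comp (by fun_prop)).norm).rpow_const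
      fun _ ↦ Or.inr hβ.le
  have hexp : ∀ y : ℝ, rexp (-(β * (cos (κ * x) * (cosh (κ * y) / cosh (κ * H))))) ≤
      rexp (-(β / 2 * (cosh (κ * y) / cosh (κ * H)))) := by
    intro y
    have : 0 < cosh (κ * y) / cosh (κ * H) := div_pos (cosh_pos _) (cosh_pos _)
    refine exp_le_exp.mpr (neg_le_neg ?_)
    have h2 := mul_le_mul_of_nonneg_right hcos this.le
    nlinarith
  set g : ℝ → ℝ := (Ioc (-(2 * H)) (2 * H)).indicator fun y ↦
    ‖riemannZeta₁ ((1 / 2 + x : ℝ) + (τ + y : ℝ) * Complex.I)‖ ^ β with hg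
  have hgint : Integrable g := by
    rw [hg, integrable_indicator_iff measurableSet_Ioc]
    exact (hζ.integrableOn_Icc).mono_set Ioc_subset_Icc_self
  have hDint : Integrable fun y : ℝ ↦ D * (1 + y ^ 2)⁻¹ := integrable_inv_one_add_sq.const_mul D
  calc _ ≤ ∫ y : ℝ, rexp (-(μ * x)) * (g y + D * (1 + y ^ 2)⁻¹) := by
        refine integral_mono_of_nonneg (.of_forall fun y ↦ by positivity)
          ((hgint.add hDint).const_mul _) (.of_forall fun y ↦ ?_)
        simp only
        rw [norm_localizedZeta_rpow hβ, mul_comm]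
        refine mul_le_mul_of_nonneg_left ?_ (exp_pos _).le
        by_cases hy : y ∈ Ioc (-(2 * H)) (2 * H)
        · rw [hg, indicator_of_mem hy]
          have : 0 ≤ D * (1 + y ^ 2)⁻¹ := by positivity
          refine (mul_le_of_le_one_right (by positivity) ?_).trans (le_add_of_nonneg_right this)
          refine (hexp y).trans (exp_le_one_iff.mpr ?_)
          have := div_pos (cosh_pos (κ * y)) (cosh_pos (κ * H))
          nlinarith
        · rw [hg, indicator_of_notMem hy, zero_add, ← div_eq_mul_inv]
          refine (mul_le_mul_of_nonneg_left (hexp y) (by positivity)).trans (htail x hx y ?_)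
          rw [mem_Ioc, not_and_or, not_lt, not_le] at hy
          rw [le_abs]
          rcases hy with h | h
          · right; linarith
          · left; exact h.le
    _ = _ := by
        rw [integral_const_mul, integral_add hgint hDint, integral_const_mul,
          integral_univ_inv_one_add_sq, hg, integral_indicator measurableSet_Ioc,
          intervalIntegral.integral_of_le (by linarith)]

open Real Set in
/-- The decay required by `integral_vertical_le_add`. -/
theorem exists_localizedZeta_decay {β Δ H κ μ τ D : ℝ} (hβ : 0 < β)
    (hκ : 0 ≤ κ) (hκΔ : κ * Δ ≤ 1) (hμ : 0 ≤ μ)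
    (htail : ∀ x ∈ Icc 0 Δ, ∀ y : ℝ, 2 * H ≤ |y| →
      ‖riemannZeta₁ ((1 / 2 + x : ℝ) + (τ + y : ℝ) * Complex.I)‖ ^ β *
        rexp (-(β / 2 * (cosh (κ * y) / cosh (κ * H)))) ≤ D / (1 + y ^ 2)) :
    ∃ C, ∀ x ∈ Icc 0 Δ, ∀ y : ℝ,
      ‖localizedZeta β τ κ H μ (x + y * Complex.I)‖ ^ β ≤ C / (1 + y ^ 2) := by
  have hcont : Continuous fun p : ℝ × ℝ ↦
      ‖localizedZeta β τ κ H μ (p.1 + p.2 * Complex.I)‖ ^ β * (1 + p.2 ^ 2) := by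
    refine Continuous.mul ?_ (by fun_prop)
    exact (((differentiable_localizedZeta β τ κ H μ).continuous.comp (by fun_prop)).norm).rpow_const
      fun _ ↦ Or.inr hβ.le
  obtain ⟨C, hC⟩ := (isCompact_Icc.prod isCompact_Icc : IsCompact
    (Icc (0 : ℝ) Δ ×ˢ Icc (-(2 * H)) (2 * H))).bddAbove_image hcont.continuousOn
  refine ⟨max C D, fun x hx y ↦ ?_⟩
  have hy0 : 0 < 1 + y ^ 2 := by positivity
  rcases le_total (2 * H) |y| with hy | hy
  · have h := htail x hx y hy
    rw [le_div_iff₀ hy0] at h ⊢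
    refine le_trans ?_ (h.trans (le_max_right _ _))
    refine mul_le_mul_of_nonneg_right ?_ hy0.le
    rw [norm_localizedZeta_rpow hβ]
    have hcos : 1 / 2 ≤ cos (κ * x) := by
      have h0 : 0 ≤ κ * x := mul_nonneg hκ hx.1
      have h1 : κ * x ≤ 1 := (mul_le_mul_of_nonneg_left hx.2 hκ).trans hκΔ
      have := one_sub_sq_div_two_le_cos (x := κ * x)
      nlinarith
    refine (mul_le_of_le_one_right (by positivity) ?_).trans
      (mul_le_mul_of_nonneg_left ?_ (by positivity))
    · exact exp_le_one_iff.mpr (by have := mul_nonneg hμ hx.1; linarith)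
    · have : 0 < cosh (κ * y) / cosh (κ * H) := div_pos (cosh_pos _) (cosh_pos _)
      refine exp_le_exp.mpr (neg_le_neg ?_)
      have h2 := mul_le_mul_of_nonneg_right hcos this.le
      nlinarith
  · rw [le_div_iff₀ hy0]
    refine le_trans (hC ⟨(x, y), ⟨hx, abs_le.mp hy⟩, rfl⟩) (le_max_left _ _)

open Real Set in
/-- The lower bound used inside the strip: the cut-off is at least `exp (-1)` on `[-H, H]`. -/
theorem le_integral_localizedZeta {β Δ H κ μ τ C : ℝ} (hβ : 0 < β) (hH : 0 < H)
    (hC : ∀ x ∈ Icc 0 Δ, ∀ y : ℝ,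
      ‖localizedZeta β τ κ H μ (x + y * Complex.I)‖ ^ β ≤ C / (1 + y ^ 2))
    {x : ℝ} (hx : x ∈ Icc 0 Δ) :
    rexp (-(μ * x)) * rexp (-β) * (∫ y in (-H)..H,
        ‖riemannZeta₁ ((1 / 2 + x : ℝ) + (τ + y : ℝ) * Complex.I)‖ ^ β) ≤
      ∫ y : ℝ, ‖localizedZeta β τ κ H μ (x + y * Complex.I)‖ ^ β := by
  have hζ : Continuous fun y : ℝ ↦
      ‖riemannZeta₁ ((1 / 2 + x : ℝ) + (τ + y : ℝ) * Complex.I)‖ ^ β :=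
    ((differentiable_riemannZeta₁.continuous.comp (by fun_prop)).norm).rpow_const
      fun _ ↦ Or.inr hβ.le
  have hf : Continuous fun y : ℝ ↦ ‖localizedZeta β τ κ H μ (x + y * Complex.I)‖ ^ β :=
    (((differentiable_localizedZeta β τ κ H μ).continuous.comp (by fun_prop)).norm).rpow_const
      fun _ ↦ Or.inr hβ.le
  have hfint : Integrable fun y : ℝ ↦ ‖localizedZeta β τ κ H μ (x + y * Complex.I)‖ ^ β := by
    refine (integrable_inv_one_add_sq.const_mul C).mono' hf.aestronglyMeasurable
      (.of_forall fun y ↦ ?_)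
    rw [norm_of_nonneg (by positivity), ← div_eq_mul_inv]
    exact hC x hx y
  rw [intervalIntegral.integral_of_le (by linarith), ← integral_const_mul]
  refine le_trans ?_ (setIntegral_le_integral (s := Ioc (-H) H) hfint
    (.of_forall fun y ↦ by positivity))
  refine setIntegral_mono_on ((hζ.integrableOn_Icc.mono_set Ioc_subset_Icc_self).const_mul _)
    hfint.integrableOn measurableSet_Ioc fun y hy ↦ ?_
  rw [norm_localizedZeta_rpow hβ, mul_comm, mul_comm (rexp (-(μ * x))), ← mul_assoc]
  refine mul_le_mul_of_nonneg_right (mul_le_mul_of_nonneg_left ?_ (by positivity)) (exp_pos _).le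
  refine exp_le_exp.mpr (neg_le_neg (mul_le_of_le_one_right hβ.le ?_))
  have h1 : cosh (κ * y) / cosh (κ * H) ≤ 1 := by
    rw [div_le_one (cosh_pos _), cosh_le_cosh, abs_mul, abs_mul]
    refine mul_le_mul_of_nonneg_left ?_ (abs_nonneg _)
    rw [abs_of_pos hH, abs_le]
    exact ⟨hy.1.le, hy.2⟩
  have h0 : 0 < cosh (κ * y) / cosh (κ * H) := div_pos (cosh_pos _) (cosh_pos _)
  nlinarith [cos_le_one (κ * x)]

/-! ### Comparison of `ζ` with `ζ₁` and the tail estimate -/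

open Real Set in
theorem norm_riemannZeta₁_eq {σ t : ℝ} (ht : 0 < t) :
    ‖riemannZeta₁ (σ + t * Complex.I)‖ =
      ‖(σ + t * Complex.I : ℂ) - 1‖ * ‖riemannZeta (σ + t * Complex.I)‖ := by
  have h1 : (σ + t * Complex.I : ℂ) ≠ 1 := fun h ↦ by
    have := congrArg Complex.im h
    simp at this
    exact ht.ne' this
  rw [riemannZeta_eq_inv_sub_mul h1, norm_mul, norm_inv,
    mul_inv_cancel_left₀ (norm_ne_zero_iff.mpr (sub_ne_zero.mpr h1))]

theorem zetaMoment_eq (β σ τ H : ℝ) :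
    zetaMoment β σ τ H =
      ∫ u in (-H)..H, ‖riemannZeta (σ + (τ + u : ℝ) * Complex.I)‖ ^ β := by
  unfold zetaMoment
  congr 1 with u
  congr 3
  push_cast; ring

open Real Set in
theorem zetaMoment_le {β σ τ H T : ℝ} (hβ : 0 < β) (hT : 0 < T) (hH : 0 ≤ H) (hHT : H ≤ T / 2)
    (hτ : T ≤ τ) :
    (T / 2) ^ β * zetaMoment β σ τ H ≤
      ∫ u in (-H)..H, ‖riemannZeta₁ (σ + (τ + u : ℝ) * Complex.I)‖ ^ β := by
  have hζ : Continuous fun y : ℝ ↦ ‖riemannZeta₁ (σ + (τ + y : ℝ) * Complex.I)‖ ^ β :=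
    ((differentiable_riemannZeta₁.continuous.comp (by fun_prop)).norm).rpow_const
      fun _ ↦ Or.inr hβ.le
  rw [zetaMoment_eq, ← intervalIntegral.integral_const_mul,
    intervalIntegral.integral_of_le (by linarith), intervalIntegral.integral_of_le (by linarith)]
  refine integral_mono_of_nonneg (.of_forall fun u ↦ by positivity)
    (hζ.integrableOn_Icc.mono_set Ioc_subset_Icc_self) ?_
  filter_upwards [ae_restrict_mem measurableSet_Ioc] with u hu
  have ht : T / 2 ≤ τ + u := by linarith [hu.1]
  rw [norm_riemannZeta₁_eq (by linarith), ← mul_rpow (by positivity) (by positivity)]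
  refine rpow_le_rpow (by positivity) (mul_le_mul_of_nonneg_right ?_ (by positivity)) hβ.le
  have := Complex.abs_im_le_norm ((σ + (τ + u : ℝ) * Complex.I : ℂ) - 1)
  simp only [Complex.sub_im, Complex.add_im, Complex.mul_im, Complex.ofReal_re, Complex.ofReal_im,
    Complex.I_re, Complex.I_im, Complex.one_im, mul_one, mul_zero, zero_add, add_zero,
    sub_zero] at this
  exact ht.trans ((le_abs_self _).trans this)

open Real Set in
theorem le_zetaMoment {β τ H T : ℝ} (hβ : 0 < β) (hT : 1 ≤ T) (hH : 0 ≤ H) (hHT : H ≤ T / 2)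
    (hτ : T ≤ τ) (hτ2 : τ ≤ 2 * T) :
    ∫ u in (-H)..H, ‖riemannZeta₁ ((1 / 2 : ℝ) + (τ + u : ℝ) * Complex.I)‖ ^ β ≤
      (4 * T) ^ β * zetaMoment β (1 / 2) τ H := by
  have hζ : ContinuousOn (fun y : ℝ ↦
      ‖riemannZeta ((1 / 2 : ℝ) + (τ + y : ℝ) * Complex.I)‖ ^ β) (Icc (-H) H) := by
    refine ContinuousOn.rpow_const (ContinuousOn.norm fun y hy ↦ ?_) fun _ _ ↦ Or.inr hβ.le
    have h1 : (((1 / 2 : ℝ) : ℂ) + (τ + y : ℝ) * Complex.I) ≠ 1 := fun h ↦ by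
      have := congrArg Complex.im h
      simp at this
      linarith [hy.1]
    refine ContinuousAt.continuousWithinAt ?_
    exact (differentiableAt_riemannZeta h1).continuousAt.comp (f := fun y : ℝ ↦
      (((1 / 2 : ℝ) : ℂ) + (τ + y : ℝ) * Complex.I)) (by fun_prop)
  rw [zetaMoment_eq, ← intervalIntegral.integral_const_mul,
    intervalIntegral.integral_of_le (by linarith), intervalIntegral.integral_of_le (by linarith)]
  refine integral_mono_of_nonneg (.of_forall fun u ↦ by positivity)
    ((hζ.integrableOn_Icc.mono_set Ioc_subset_Icc_self).const_mul _) ?_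
  filter_upwards [ae_restrict_mem measurableSet_Ioc] with u hu
  rw [norm_riemannZeta₁_eq (by linarith [hu.1]), ← mul_rpow (by positivity) (by positivity)]
  refine rpow_le_rpow (by positivity) (mul_le_mul_of_nonneg_right ?_ (by positivity)) hβ.le
  rw [show ((1 / 2 : ℝ) + (τ + u : ℝ) * Complex.I : ℂ) - 1 =
    ((-1 / 2 : ℝ) : ℂ) + (τ + u : ℝ) * Complex.I by push_cast; ring]
  refine (norm_add_le _ _).trans ?_
  rw [norm_mul, Complex.norm_I, mul_one, Complex.norm_real, Complex.norm_real, norm_eq_abs,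
    norm_eq_abs, abs_of_nonneg (show 0 ≤ τ + u by linarith [hu.1]),
    abs_of_neg (show (-1 / 2 : ℝ) < 0 by norm_num)]
  linarith [hu.2]

open Real Filter in
/-- The elementary inequality behind the tail estimate. It is applied with `v = κ |y| / 2`, and then
`v ^ q` bounds `log T` and `3 v ^ (p + 1)` bounds `1 + |y|`. -/
theorem eventually_mul_exp_rpow_le_exp_cosh {β : ℝ} (hβ : 0 < β) {p q : ℝ} (hp : 0 ≤ p)
    (hq : 0 ≤ q) :
    ∀ᶠ v : ℝ in atTop, 64 ^ β * rexp (β * v ^ q) * (3 * v ^ (p + 1)) ^ (2 * β + 2) * v ^ (7 * q) ≤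
      rexp (β / 2 * cosh v) := by
  set k : ℝ := (p + 1) * (2 * β + 2) + 7 * q with hk
  set c : ℝ := log (64 ^ β * 3 ^ (2 * β + 2)) with hc
  have h1 : (fun v : ℝ ↦ c + β * v ^ q + k * v) =o[atTop] rexp := by
    have e1 : (fun _ : ℝ ↦ c) =o[atTop] rexp :=
      (Asymptotics.isLittleO_const_left.mpr (Or.inr
        (tendsto_norm_atTop_atTop.comp tendsto_exp_atTop)))
    have e2 := (isLittleO_rpow_exp_atTop q).const_mul_left β
    have e3 := (isLittleO_rpow_exp_atTop 1).const_mul_left k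
    simp only [rpow_one] at e3
    exact (e1.add e2).add e3
  filter_upwards [h1.bound (show (0 : ℝ) < β / 4 by positivity), eventually_ge_atTop 1] with v hv hv1
  have hv0 : 0 < v := by linarith
  have hlog : log v ≤ v := (log_le_sub_one_of_pos hv0).trans (by linarith)
  have hlhs : 64 ^ β * rexp (β * v ^ q) * (3 * v ^ (p + 1)) ^ (2 * β + 2) * v ^ (7 * q) =
      rexp (c + β * v ^ q + k * log v) := by
    rw [exp_add, exp_add, hc, exp_log (by positivity), mul_rpow (by positivity) (by positivity),
      ← rpow_mul hv0.le, mul_comm k, ← rpow_def_of_pos hv0, hk, rpow_add hv0]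
    ring
  have hk0 : 0 ≤ k := by positivity
  rw [hlhs]
  refine exp_le_exp.mpr ?_
  have h2 : k * log v ≤ k * v := by gcongr
  have h3 := (le_abs_self _).trans hv
  rw [norm_of_nonneg (exp_pos v).le] at h3
  have h4 : rexp v / 2 ≤ cosh v := by
    rw [cosh_eq]
    linarith [exp_pos (-v)]
  nlinarith

open Real in
theorem norm_riemannZeta₁_rpow_le {β T x y τ : ℝ} (hβ : 0 < β) (hT : 2 ≤ T) (hx : 0 ≤ x)
    (hxT : x ≤ T) (hτ : T ≤ τ) (hτ2 : τ ≤ 2 * T) :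
    ‖riemannZeta₁ ((1 / 2 + x : ℝ) + (τ + y : ℝ) * Complex.I)‖ ^ β ≤
      64 ^ β * T ^ (2 * β) * (1 + |y|) ^ (2 * β) := by
  set s : ℂ := (1 / 2 + x : ℝ) + (τ + y : ℝ) * Complex.I with hs
  have hsre : s.re = 1 / 2 + x := by simp [hs]
  have hy := abs_nonneg y
  have hsn : 1 + ‖s‖ ≤ 4 * T * (1 + |y|) := by
    have h1 : ‖s‖ ≤ (1 / 2 + x) + (2 * T + |y|) := by
      refine (norm_add_le _ _).trans ?_
      rw [norm_mul, Complex.norm_I, mul_one, Complex.norm_real, Complex.norm_real,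
        norm_of_nonneg (by linarith), norm_eq_abs]
      refine add_le_add le_rfl ((abs_add_le _ _).trans ?_)
      rw [abs_of_nonneg (by linarith)]
      linarith
    nlinarith
  have h2 : ‖riemannZeta₁ s‖ ≤ 64 * (T ^ 2 * (1 + |y|) ^ 2) := by
    refine (norm_riemannZeta₁_le (by rw [hsre]; linarith)).trans ?_
    calc 4 * (1 + ‖s‖) ^ 2 ≤ 4 * (4 * T * (1 + |y|)) ^ 2 := by gcongr
      _ = _ := by ring
  refine (rpow_le_rpow (norm_nonneg _) h2 hβ.le).trans_eq ?_
  rw [mul_rpow (by positivity) (by positivity), mul_rpow (by positivity) (by positivity),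
    ← rpow_natCast, ← rpow_natCast, ← rpow_mul (by linarith), ← rpow_mul (by positivity)]
  push_cast; ring

open Real in
theorem cosh_half_le_cosh_div_cosh {κ H y : ℝ} (hκ : 0 ≤ κ) (hH : 0 ≤ H) (hy : 2 * H ≤ |y|) :
    cosh (κ * |y| / 2) ≤ cosh (κ * y) / cosh (κ * H) := by
  rw [le_div_iff₀ (cosh_pos _)]
  have h1 : cosh (κ * y) = cosh (κ * (|y| - H) + κ * H) := by
    rw [← cosh_abs, abs_mul, abs_of_nonneg hκ]
    congr 1; ring
  have hle : κ * |y| / 2 ≤ κ * (|y| - H) := by nlinarith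
  have h0 : 0 ≤ κ * |y| / 2 := by positivity
  have h2 : cosh (κ * |y| / 2) ≤ cosh (κ * (|y| - H)) := by
    rw [cosh_le_cosh, abs_of_nonneg h0, abs_of_nonneg (h0.trans hle)]
    exact hle
  rw [h1, cosh_add]
  have h3 : 0 ≤ sinh (κ * (|y| - H)) := sinh_nonneg_iff.mpr (h0.trans hle)
  have h4 : 0 ≤ sinh (κ * H) := sinh_nonneg_iff.mpr (by positivity)
  have := mul_le_mul_of_nonneg_right h2 (cosh_pos (κ * H)).le
  nlinarith

open Real Filter in
/-- At distance at least `2H` from the centre the cut-off beats the polynomial growth of `ζ₁`, with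
a power of `log T` and an integrable factor to spare. -/
theorem eventually_norm_riemannZeta₁_rpow_mul_exp_le {β θ ε : ℝ} (hβ : 0 < β) (hε : 0 < ε) :
    ∀ᶠ T : ℝ in atTop, ∀ τ x y : ℝ, T ≤ τ → τ ≤ 2 * T → 0 ≤ x → x ≤ T →
      2 * log T ^ θ ≤ |y| →
      ‖riemannZeta₁ ((1 / 2 + x : ℝ) + (τ + y : ℝ) * Complex.I)‖ ^ β *
        rexp (-(β / 2 * (cosh (log T ^ (ε - θ) * y) / cosh (log T ^ (ε - θ) * log T ^ θ)))) ≤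
      T ^ β * log T ^ (-7 : ℝ) / (1 + y ^ 2) := by
  have hv := eventually_mul_exp_rpow_le_exp_cosh hβ (p := |θ| / ε) (q := 1 / ε) (by positivity)
    (by positivity)
  obtain ⟨v₀, hv₀⟩ := eventually_atTop.mp hv
  have hlim : Tendsto (fun T : ℝ ↦ log T ^ ε) atTop atTop :=
    (tendsto_rpow_atTop hε).comp tendsto_log_atTop
  filter_upwards [hlim.eventually_ge_atTop v₀, tendsto_log_atTop.eventually_ge_atTop 1,
    eventually_ge_atTop 2] with T hT0 hL hT2 τ x y hτ hτ2 hx hxT hy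
  set L := log T with hLdef
  have hLpos : 0 < L := by linarith
  have hTpos : 0 < T := by linarith
  set κ := L ^ (ε - θ) with hκdef
  have hκ : 0 < κ := by positivity
  have hκH : κ * L ^ θ = L ^ ε := by rw [hκdef, ← rpow_add hLpos]; congr 1; ring
  set v := κ * |y| / 2 with hvdef
  have hvge : L ^ ε ≤ v := by
    rw [← hκH, hvdef]
    nlinarith
  have hW1 : 1 ≤ L ^ ε := one_le_rpow hL hε.le
  have hv1 : 1 ≤ v := hW1.trans hvge
  have hvpos : 0 < v := by linarith
  have hmain := hv₀ v (hT0.trans hvge)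
  -- `L` and `|y|` are at most powers of `v`.
  have hLv : L ≤ v ^ (1 / ε) := by
    calc L = (L ^ ε) ^ (1 / ε) := by rw [← rpow_mul hLpos.le, mul_one_div_cancel hε.ne', rpow_one]
      _ ≤ _ := by gcongr
  have hyv : 1 + |y| ≤ 3 * v ^ (|θ| / ε + 1) := by
    have h1 : |y| = 2 * v * L ^ (θ - ε) := by
      have : κ * L ^ (θ - ε) = 1 := by rw [hκdef, ← rpow_add hLpos]; simp
      rw [hvdef]
      linear_combination (-|y|) * this
    have h2 : L ^ (θ - ε) ≤ v ^ (|θ| / ε) := by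
      calc L ^ (θ - ε) ≤ L ^ |θ| := rpow_le_rpow_of_exponent_le hL (by linarith [le_abs_self θ])
        _ ≤ (v ^ (1 / ε)) ^ |θ| := by gcongr
        _ = _ := by rw [← rpow_mul hvpos.le]; congr 1; ring
    have h3 : 1 ≤ v ^ (|θ| / ε + 1) := one_le_rpow hv1 (by positivity)
    rw [h1]
    have h4 : v ^ (|θ| / ε + 1) = v ^ (|θ| / ε) * v := by rw [rpow_add hvpos, rpow_one]
    have h5 : 2 * v * L ^ (θ - ε) ≤ 2 * v * v ^ (|θ| / ε) := by gcongr
    nlinarith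
  have hcosh := cosh_half_le_cosh_div_cosh hκ.le (by positivity : 0 ≤ L ^ θ) hy
  have hy2 : 1 + y ^ 2 ≤ (1 + |y|) ^ (2 : ℝ) := by
    rw [rpow_ofNat]
    nlinarith [abs_nonneg y, sq_abs y]
  have hT2β : T ^ (2 * β) = T ^ β * rexp (β * L) := by
    rw [two_mul, rpow_add hTpos, mul_comm β L, hLdef, ← rpow_def_of_pos hTpos]
  rw [le_div_iff₀ (by positivity), rpow_neg hLpos.le, ← div_eq_mul_inv, le_div_iff₀ (by positivity)]
  calc _ ≤ (64 ^ β * T ^ (2 * β) * (1 + |y|) ^ (2 * β)) * rexp (-(β / 2 * cosh v)) *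
        (1 + |y|) ^ (2 : ℝ) * L ^ (7 : ℝ) := by
        gcongr
        exact norm_riemannZeta₁_rpow_le hβ hT2 hx hxT hτ hτ2
    _ = T ^ β * (64 ^ β * rexp (β * L) * (1 + |y|) ^ (2 * β + 2) * L ^ (7 : ℝ)) *
        rexp (-(β / 2 * cosh v)) := by
        rw [hT2β, rpow_add (by positivity) (2 * β) 2]; ring
    _ ≤ T ^ β * (64 ^ β * rexp (β * v ^ (1 / ε)) * (3 * v ^ (|θ| / ε + 1)) ^ (2 * β + 2) *
        (v ^ (1 / ε)) ^ (7 : ℝ)) * rexp (-(β / 2 * cosh v)) := by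
        gcongr
    _ = T ^ β * (64 ^ β * rexp (β * v ^ (1 / ε)) * (3 * v ^ (|θ| / ε + 1)) ^ (2 * β + 2) *
        v ^ (7 * (1 / ε))) * rexp (-(β / 2 * cosh v)) := by
        rw [← rpow_mul hvpos.le, mul_comm (1 / ε) 7]
    _ ≤ T ^ β * rexp (β / 2 * cosh v) * rexp (-(β / 2 * cosh v)) := by gcongr
    _ = T ^ β := by rw [mul_assoc, ← exp_add, add_neg_cancel, exp_zero, mul_one]

/-! ### The comparison of moments -/

open Real Set in
/-- The deterministic part: the moments are comparable as soon as `ζ₁` is at most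
`T * (log T) ^ (K / 2)` on the segment of length `4H` on the line `Re s = 1/2 + Δ`. -/
theorem zetaMoment_le_of_norm_riemannZeta₁_sq_le {β θ ε K T τ σ : ℝ} (hβ : 0 < β) (hε : 0 < ε)
    (hK : 0 ≤ K) (hT : 2 ≤ T) (hL : 1 ≤ log T) (hHT : 2 * log T ^ θ ≤ T / 2)
    (hΔT : log T ^ (θ - 2 * ε) ≤ T) (hτ : T ≤ τ) (hτ2 : τ ≤ 2 * T)
    (hσ : 1 / 2 ≤ σ) (hσ2 : σ ≤ 1 / 2 + log T ^ (θ - 3 * ε))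
    (htail : ∀ τ x y : ℝ, T ≤ τ → τ ≤ 2 * T → 0 ≤ x → x ≤ T → 2 * log T ^ θ ≤ |y| →
      ‖riemannZeta₁ ((1 / 2 + x : ℝ) + (τ + y : ℝ) * Complex.I)‖ ^ β *
        rexp (-(β / 2 * (cosh (log T ^ (ε - θ) * y) / cosh (log T ^ (ε - θ) * log T ^ θ)))) ≤
      T ^ β * log T ^ (-7 : ℝ) / (1 + y ^ 2))
    (hbd : ∀ u ∈ Icc (-(2 * log T ^ θ)) (2 * log T ^ θ),
      ‖riemannZeta₁ ((1 / 2 + log T ^ (θ - 2 * ε) : ℝ) + (τ + u : ℝ) * Complex.I)‖ ^ 2 ≤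
        T ^ 2 * log T ^ K) :
    zetaMoment β σ τ (log T ^ θ) ≤
      rexp ((|θ| + K * β / 2 + 7) / ε + β) * 2 ^ β * (4 ^ β + 2 * π + 4) *
        (zetaMoment β (1 / 2) τ (2 * log T ^ θ) + 1 / log T ^ 7) := by
  set L := log T with hLdef
  set H := L ^ θ with hH
  set Δ := L ^ (θ - 2 * ε) with hΔ
  set κ := L ^ (ε - θ) with hκ
  -- `L ^ (-B)` compensates the length `4H` and the size `L ^ (K β / 2)` on the right edge, and
  -- leaves `L ^ (-7)`.
  set B := |θ| + K * β / 2 + 7 with hB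
  set μ := B * log L / Δ with hμ
  set ρ := L ^ (-7 : ℝ) with hρ
  have hL0 : 0 < L := by linarith
  have hT0 : 0 < T := by linarith
  have hHpos : 0 < H := by positivity
  have hΔpos : 0 < Δ := by positivity
  have hκpos : 0 < κ := by positivity
  have hρpos : 0 < ρ := by positivity
  have hBpos : 0 < B := by positivity
  have hlogL : 0 ≤ log L := log_nonneg hL
  have hμ0 : 0 ≤ μ := by positivity
  have hκΔ : κ * Δ ≤ 1 := by
    rw [hκ, hΔ, ← rpow_add hL0]
    exact rpow_le_one_of_one_le_of_nonpos hL (by linarith)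
  set x := σ - 1 / 2 with hx
  have hx0 : 0 ≤ x := by linarith
  have hxle : x ≤ L ^ (θ - 3 * ε) := by linarith
  have hxΔ : x ≤ Δ := hxle.trans (rpow_le_rpow_of_exponent_le hL (by linarith))
  have hxmem : x ∈ Icc 0 Δ := ⟨hx0, hxΔ⟩
  have htail' : ∀ x ∈ Icc 0 Δ, ∀ y : ℝ, 2 * H ≤ |y| →
      ‖riemannZeta₁ ((1 / 2 + x : ℝ) + (τ + y : ℝ) * Complex.I)‖ ^ β *
        rexp (-(β / 2 * (cosh (κ * y) / cosh (κ * H)))) ≤ T ^ β * ρ / (1 + y ^ 2) :=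
    fun x hx y hy ↦ htail τ x y hτ hτ2 hx.1 (hx.2.trans hΔT) hy
  obtain ⟨C, hC⟩ := exists_localizedZeta_decay hβ hκpos.le hκΔ hμ0 htail'
  have hD : 0 ≤ T ^ β * ρ := by positivity
  -- The exponential tilt costs a bounded factor at `x` and gains `L ^ (-B)` at `Δ`.
  have hμx : μ * x ≤ B / ε := by
    have h1 : μ * x ≤ B * log L * L ^ (-ε) := by
      calc μ * x ≤ μ * L ^ (θ - 3 * ε) := by gcongr
        _ = B * log L * (L ^ (θ - 3 * ε) / L ^ (θ - 2 * ε)) := by rw [hμ]; ring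
        _ = _ := by rw [← rpow_sub hL0]; congr 2; ring
    have h2 := log_le_rpow_div hL0.le hε
    refine h1.trans ?_
    calc B * log L * L ^ (-ε) ≤ B * (L ^ ε / ε) * L ^ (-ε) := by gcongr
      _ = B / ε * (L ^ ε * L ^ (-ε)) := by ring
      _ = _ := by rw [← rpow_add hL0, add_neg_cancel, rpow_zero, mul_one]
  have hμΔ : rexp (-(μ * Δ)) = L ^ (-B) := by
    rw [hμ, div_mul_cancel₀ _ hΔpos.ne', rpow_def_of_pos hL0]
    congr 1; ring
  have hlow := le_integral_localizedZeta hβ hHpos hC hxmem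
  have hconv := integral_vertical_le_add (differentiable_localizedZeta β τ κ H μ) hβ hΔpos hC hxmem
  have hup0 := integral_localizedZeta_le (μ := μ) hβ hHpos hκpos.le hκΔ hD htail'
    (left_mem_Icc.mpr hΔpos.le)
  have hup1 := integral_localizedZeta_le (μ := μ) hβ hHpos hκpos.le hκΔ hD htail'
    (right_mem_Icc.mpr hΔpos.le)
  rw [mul_zero, neg_zero, exp_zero, one_mul, add_zero] at hup0
  rw [hμΔ] at hup1
  have hzσ := zetaMoment_le (σ := σ) hβ hT0 hHpos.le (by linarith) hτ
  have hzhalf := le_zetaMoment hβ (by linarith) (by positivity) hHT hτ hτ2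
  rw [show 1 / 2 + x = σ by rw [hx]; ring] at hlow
  set Zσ := zetaMoment β σ τ H
  set Z := zetaMoment β (1 / 2) τ (2 * H)
  have hright : ∫ y in (-(2 * H))..(2 * H),
      ‖riemannZeta₁ ((1 / 2 + Δ : ℝ) + (τ + y : ℝ) * Complex.I)‖ ^ β ≤
        T ^ β * L ^ (K * β / 2) * (4 * H) := by
    have hζ : Continuous fun y : ℝ ↦
        ‖riemannZeta₁ ((1 / 2 + Δ : ℝ) + (τ + y : ℝ) * Complex.I)‖ ^ β :=
      ((differentiable_riemannZeta₁.continuous.comp (by fun_prop)).norm).rpow_const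
        fun _ ↦ Or.inr hβ.le
    have := intervalIntegral.integral_mono_on (a := -(2 * H)) (b := 2 * H) (μ := volume)
      (g := fun _ ↦ T ^ β * L ^ (K * β / 2)) (by linarith)
      (hζ.intervalIntegrable _ _) (continuous_const.intervalIntegrable _ _) fun u hu ↦ ?_
    · refine this.trans_eq ?_
      rw [intervalIntegral.integral_const, smul_eq_mul]
      ring
    · have h := rpow_le_rpow (by positivity) (hbd u hu) (show 0 ≤ β / 2 by positivity)
      rw [← rpow_natCast, ← rpow_mul (norm_nonneg _), mul_rpow (by positivity) (by positivity),
        ← rpow_natCast, ← rpow_mul hT0.le, ← rpow_mul hL0.le] at h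
      convert h using 2
      · push_cast; ring
      · congr 1; push_cast; ring
      · congr 1; ring
  have hgain : L ^ (-B) * (L ^ (K * β / 2) * (4 * H)) ≤ 4 * ρ := by
    calc _ = 4 * L ^ (-B + K * β / 2 + θ) := by
          rw [rpow_add hL0, rpow_add hL0]; ring
      _ ≤ 4 * ρ := by
          refine mul_le_mul_of_nonneg_left (rpow_le_rpow_of_exponent_le hL ?_) (by norm_num)
          rw [hB]; linarith [le_abs_self θ]
  have hLB : L ^ (-B) ≤ 1 := rpow_le_one_of_one_le_of_nonpos hL (by linarith)
  have hZ0 : 0 ≤ Z := intervalIntegral.integral_nonneg (by linarith) fun u _ ↦ by positivity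
  have hρeq : ρ = 1 / L ^ 7 := by
    rw [hρ, rpow_neg hL0.le, one_div]
    congr 1
    exact_mod_cast rpow_natCast L 7
  rw [← hρeq]
  have hTβ : 0 < T ^ β := by positivity
  have hsum : rexp (-(μ * x)) * rexp (-β) * ((T / 2) ^ β * Zσ) ≤
      T ^ β * ((4 ^ β + 2 * π + 4) * (Z + ρ)) := by
    have e0 : (4 * T) ^ β * Z + T ^ β * ρ * π = T ^ β * (4 ^ β * Z + ρ * π) := by
      rw [mul_rpow (by norm_num) hT0.le]; ring
    have e1 : L ^ (-B) * (T ^ β * L ^ (K * β / 2) * (4 * H) + T ^ β * ρ * π) ≤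
        T ^ β * (4 * ρ + ρ * π) := by
      calc _ = T ^ β * (L ^ (-B) * (L ^ (K * β / 2) * (4 * H)) + L ^ (-B) * (ρ * π)) := by ring
        _ ≤ T ^ β * (4 * ρ + 1 * (ρ * π)) := by gcongr
        _ = _ := by ring
    have e2 : 4 ^ β * Z + ρ * π + (4 * ρ + ρ * π) ≤ (4 ^ β + 2 * π + 4) * (Z + ρ) := by
      have a1 : (0 : ℝ) < 4 ^ β := by positivity
      have a2 := mul_nonneg pi_pos.le hZ0
      have a3 := mul_pos a1 hρpos
      nlinarith
    calc _ ≤ _ := mul_le_mul_of_nonneg_left hzσ (by positivity)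
      _ ≤ _ := hlow
      _ ≤ _ := hconv
      _ ≤ ((4 * T) ^ β * Z + T ^ β * ρ * π) +
          L ^ (-B) * (T ^ β * L ^ (K * β / 2) * (4 * H) + T ^ β * ρ * π) := by
          refine add_le_add (hup0.trans (add_le_add hzhalf le_rfl)) (hup1.trans ?_)
          gcongr
      _ ≤ T ^ β * (4 ^ β * Z + ρ * π) + T ^ β * (4 * ρ + ρ * π) := add_le_add e0.le e1
      _ = T ^ β * (4 ^ β * Z + ρ * π + (4 * ρ + ρ * π)) := by ring
      _ ≤ _ := by gcongr
  have hT2 : (T / 2) ^ β = T ^ β / 2 ^ β := div_rpow hT0.le (by norm_num) β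
  have hR0 : 0 ≤ (4 ^ β + 2 * π + 4) * (Z + ρ) := by positivity
  have hfin : Zσ ≤ rexp (μ * x + β) * 2 ^ β * ((4 ^ β + 2 * π + 4) * (Z + ρ)) := by
    rw [hT2] at hsum
    have h2 : (0 : ℝ) < 2 ^ β := by positivity
    have h3 : rexp (-(μ * x)) * rexp (-β) * rexp (μ * x + β) = 1 := by
      rw [← exp_add, ← exp_add, ← exp_zero]; congr 1; ring
    have h4 : rexp (-(μ * x)) * rexp (-β) * Zσ ≤ 2 ^ β * ((4 ^ β + 2 * π + 4) * (Z + ρ)) := by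
      refine le_of_mul_le_mul_left ?_ hTβ
      have := mul_le_mul_of_nonneg_left hsum h2.le
      calc _ = 2 ^ β * (rexp (-(μ * x)) * rexp (-β) * (T ^ β / 2 ^ β * Zσ)) := by field_simp
        _ ≤ _ := this
        _ = _ := by ring
    calc Zσ = rexp (μ * x + β) * (rexp (-(μ * x)) * rexp (-β) * Zσ) := by
          linear_combination (-Zσ) * h3
      _ ≤ rexp (μ * x + β) * (2 ^ β * ((4 ^ β + 2 * π + 4) * (Z + ρ))) := by gcongr
      _ = _ := by ring
  refine hfin.trans ?_
  rw [mul_assoc (rexp (B / ε + β) * 2 ^ β)]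
  gcongr

open Real Filter in
theorem eventually_mul_log_rpow_le (c p : ℝ) : ∀ᶠ T : ℝ in atTop, c * log T ^ p ≤ T := by
  have h := ((isLittleO_log_rpow_rpow_atTop p one_pos).const_mul_left c).bound one_pos
  filter_upwards [h, eventually_ge_atTop 0] with T hT hT0
  rw [one_mul, rpow_one, norm_of_nonneg hT0] at hT
  exact (le_abs_self _).trans hT

open Real Set Filter in
theorem eventually_one_sub_le_uniformLaw {θ β ε : ℝ} (hβ : 0 < β) (hε : 0 < ε) :
    ∃ C : ℝ, 0 < C ∧ ∃ D : ℝ, ∀ᶠ T : ℝ in atTop, ∀ σ : ℝ, 1 / 2 ≤ σ →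
      σ ≤ 1 / 2 + log T ^ (θ - 3 * ε) →
        1 - D / log T ≤ (uniformLaw T).real {τ : ℝ | zetaMoment β σ τ (log T ^ θ) ≤
          C * (zetaMoment β (1 / 2) τ (2 * log T ^ θ) + 1 / log T ^ 7)} := by
  obtain ⟨C₀, hC₀, hprob⟩ := exists_uniformLaw_norm_riemannZeta₁_le
  -- `K` absorbs the radius `r` (`|θ| + 2ε`), the length of the segment (`|θ|`), the logarithm of
  -- the mean square, and one more logarithm to make the probability small.
  set K := 2 * |θ| + 2 * ε + 2 with hK
  have hK0 : 0 ≤ K := by positivity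
  refine ⟨rexp ((|θ| + K * β / 2 + 7) / ε + β) * 2 ^ β * (4 ^ β + 2 * π + 4), by positivity,
    3 * C₀, ?_⟩
  filter_upwards [eventually_norm_riemannZeta₁_rpow_mul_exp_le (θ := θ) hβ hε,
    tendsto_log_atTop.eventually_ge_atTop 1, eventually_ge_atTop 4,
    eventually_mul_log_rpow_le 8 θ, eventually_mul_log_rpow_le 4 (θ - 2 * ε)]
    with T htail hL hT hHT hΔT σ hσ hσ2
  set L := log T with hLdef
  have hL0 : 0 < L := by linarith
  have hT0 : 0 < T := by linarith
  have hH0 : 0 < L ^ θ := by positivity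
  have hΔ0 : 0 < L ^ (θ - 2 * ε) := by positivity
  -- With `r ≤ Δ` the discs stay in `Re s ≥ 1/2`.
  set r := L ^ (-(|θ| + 2 * ε)) with hr
  have hr0 : 0 < r := by positivity
  have hr1 : r ≤ 1 := rpow_le_one_of_one_le_of_nonpos hL (by have := abs_nonneg θ; linarith)
  have hrΔ : r ≤ L ^ (θ - 2 * ε) :=
    rpow_le_rpow_of_exponent_le hL (by linarith [neg_abs_le θ])
  set bad : Set ℝ := {τ | ∃ u ∈ Icc (-(2 * L ^ θ)) (2 * L ^ θ), T ^ 2 * L ^ K <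
    ‖riemannZeta₁ ((1 / 2 + L ^ (θ - 2 * ε) : ℝ) + (τ + u : ℝ) * Complex.I)‖ ^ 2} with hbad
  have hbadle : uniformLaw T bad ≤ ENNReal.ofReal (3 * C₀ / L) := by
    refine (hprob T (1 / 2 + L ^ (θ - 2 * ε)) r (2 * L ^ θ) (T ^ 2 * L ^ K) (by linarith) hr0 hr1
      (by linarith) (by linarith) (by positivity) (by linarith) (by positivity)).trans ?_
    refine ENNReal.ofReal_le_ofReal ?_
    have h1 : 2 * L ^ θ + 1 ≤ 3 * L ^ |θ| := by
      have a := rpow_le_rpow_of_exponent_le hL (le_abs_self θ)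
      have b := one_le_rpow hL (abs_nonneg θ)
      linarith
    have h2 : r * L ^ K = L ^ |θ| * L ^ 2 := by
      rw [hr, ← rpow_add hL0, ← rpow_natCast, ← rpow_add hL0]
      congr 1; rw [hK]; push_cast; ring
    calc C₀ * T ^ 2 * log T * (2 * L ^ θ + 1) / (r * (T ^ 2 * L ^ K)) ≤
        C₀ * T ^ 2 * L * (3 * L ^ |θ|) / (r * (T ^ 2 * L ^ K)) := by gcongr
      _ = C₀ * T ^ 2 * L * (3 * L ^ |θ|) / (T ^ 2 * (r * L ^ K)) := by congr 1; ring
      _ = _ := by rw [h2]; field_simp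
  set good : Set ℝ := {τ : ℝ | zetaMoment β σ τ (L ^ θ) ≤
    rexp ((|θ| + K * β / 2 + 7) / ε + β) * 2 ^ β * (4 ^ β + 2 * π + 4) *
      (zetaMoment β (1 / 2) τ (2 * L ^ θ) + 1 / L ^ 7)} with hgood
  have hcover : Icc T (2 * T) ⊆ good ∪ bad := by
    intro τ hτ
    by_cases hb : τ ∈ bad
    · exact Or.inr hb
    · left
      refine zetaMoment_le_of_norm_riemannZeta₁_sq_le hβ hε hK0 (by linarith) hL (by linarith)
        (by linarith) hτ.1 hτ.2 hσ hσ2 htail fun u hu ↦ ?_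
      by_contra h
      exact hb ⟨u, hu, not_le.mp h⟩
  have hvol : volume (Icc T (2 * T)) = ENNReal.ofReal T := by
    rw [volume_Icc]; congr 1; ring
  have hprobm : IsProbabilityMeasure (uniformLaw T) := by
    refine ProbabilityTheory.cond_isProbabilityMeasure_of_finite ?_ ?_ <;> simp [hvol, hT0]
  have hone : (uniformLaw T) (Icc T (2 * T)) = 1 := by
    refine ProbabilityTheory.cond_apply_self ?_ ?_ <;> simp [hvol, hT0]
  have h1 : (1 : ENNReal) ≤ uniformLaw T good + ENNReal.ofReal (3 * C₀ / L) := by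
    rw [← hone]
    exact (measure_mono hcover).trans ((measure_union_le _ _).trans (add_le_add le_rfl hbadle))
  rw [tsub_le_iff_right]
  have h2 := ENNReal.toReal_mono (by finiteness) h1
  rwa [ENNReal.toReal_one, ENNReal.toReal_add (by finiteness) (by finiteness),
    ENNReal.toReal_ofReal (by positivity)] at h2

theorem proposition3p6 (θ β ε : ℝ) (hθ : -1 < θ) (hβ : 0 < β) (hε : 0 < ε) :
    ∃ C : ℝ, 0 < C ∧ ∃ δ : ℝ → ℝ, Filter.Tendsto δ Filter.atTop (nhds 0) ∧
      ∀ T : ℝ, (10 : ℝ) ^ 9 ≤ T →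
        ∀ σ : ℝ, 1 / 2 ≤ σ → σ ≤ 1 / 2 + Real.log T ^ (θ - 3 * ε) →
          1 - δ T ≤ (uniformLaw T).real
            {τ : ℝ | zetaMoment β σ τ (Real.log T ^ θ) ≤
              C * (zetaMoment β (1 / 2) τ (2 * Real.log T ^ θ) + 1 / Real.log T ^ 7)} := by
  obtain ⟨C, hC, D, hev⟩ := eventually_one_sub_le_uniformLaw (θ := θ) hβ hε
  obtain ⟨T₀, hT₀⟩ := Filter.eventually_atTop.mp hev
  refine ⟨C, hC, fun T ↦ if T < T₀ then 1 else D / Real.log T, ?_, fun T _ σ hσ hσ2 ↦ ?_⟩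
  · -- Below `T₀` the value `1` makes the claim trivial.
    refine (Real.tendsto_log_atTop.const_div_atTop D).congr' ?_
    filter_upwards [Filter.eventually_ge_atTop T₀] with T hT
    rw [if_neg (not_lt.mpr hT)]
  · by_cases hT : T < T₀
    · simp only [if_pos hT, sub_self]
      exact measureReal_nonneg
    · simp only [if_neg hT]
      exact hT₀ T (not_lt.mp hT) σ hσ hσ2
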